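/- **Model.** Fix $n$ qudits of local dimension $q\ge 2$. An *ansatz* is a random parameterized circuit $U_V(\theta)$ on $(\mathbb C^q)^{\otimes n}$ built from $m$ entangling gates and $p$ parameterized gates. The entangling gates $V=(V_1,\dots,V_m)$ act in a fixed order, each on a fixed pair of distinct (not necessarily adjacent) qudits; they are independent, and each is drawn from a probability measure on $\mathrm U(q^2)$ that is a unitary 2-design, i.e. $\mathbb E[V_t\otimes V_t\otimes\bar V_t\otimes\bar V_t]$ equals its Haar value. Every qudit is acted on by at least one entangling gate. Each entangling gate may be immediately preceded and succeeded by any number of parameterized gates acting on one or both of its two qudits, and there are no other gates. A parameterized gate has the form $W_l e^{-iA\theta_j}W_r$ with $W_l,W_r$ fixed unitaries and $A=A_j$ Hermitian such that $e^{-iA\theta}$ is $2\pi$-periodic in $\theta$; each such gate has its own parameter $\theta_j$. The architecture, the number of gates and the 2-designs are otherwise arbitrary. Write $\mathbb E_V$ for the average over the entangling gates and $\mathbb E_\theta$ for the average over $\theta$ uniform in $[0,2\pi]^p$. Let $M_0=I,M_1,\dots,M_{q^2-1}\in\mathbb C^{q\times q}$ satisfy $\operatorname{tr}(M_i^\dagger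 M_j)=q\,\delta_{ij}$. For $x\in\{0,\dots,q^2-1\}^n$ put $M_x=M_{x_1}\otimes\cdots\otimes M_{x_n}$, let $|x|$ be the number of nonzero entries of $x$, and let $$g_x=\mathbb E_V\,\mathbb E_\theta\,\bigl|\langle 0^n|U_V(\theta)^\dagger M_x U_V(\theta)|0^n\rangle\bigr|^2 .$$ **Statement.** There is an absolute constant $c>0$ such that for all $q\ge2$, all $n$, every ansatz as above and every such family $(M_i)$: 1. For every $x$ with $|x|\ge n/2$, $$g_x\le q^{-cn}.$$ 2. (Global observables always have barren plateaus.) Let $H$ be a Hermitian operator on $(\mathbb C^q)^{\otimes n}$ with expansion $H=\sum_x c_xM_x$, $c_x=q^{-n}\operatorname{tr}(M_x^\dagger H)$, such that $|x|\ge n/2$ whenever $c_x\ne0$, and let $f_V(\theta)=\langle 0^n|U_V(\theta)^\dagger H U_V(\theta)|0^n\rangle$. Then $$\mathbb E_V\mathbb E_\theta\, f_V(\theta)^2\le q^{-cn}\sum_x|c_x|^2,$$ $$\mathbb E_V\mathbb E_\theta\,\|\nabla f_V(\theta)\|^2\le 4\Bigl(\sum_j\|A_j\|^2\Bigr)\|H\|\;q^{-cn/2}\Bigl(\sum_x|c_x|^2\Bigr)^{1/2},$$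 where $\|\cdot\|$ denotes the operator norm of matrices and the Euclidean norm of the gradient. -/

import Mathlib

open MeasureTheory
open scoped Matrix

noncomputable section

namespace BarrenPlateau

/-! ### Two-qudit unitaries and unitary 2-designs -/

/-- The unitary group `U(q²)`, acting on the space `ℂ^q ⊗ ℂ^q` of two qudits. -/
abbrev TwoQuditUnitary (q : ℕ) : Type :=
  ↥(Matrix.unitaryGroup (Fin q × Fin q) ℂ)

instance (q : ℕ) : MeasurableSpace (TwoQuditUnitary q) := borel _

instance (q : ℕ) : BorelSpace (TwoQuditUnitary q) := ⟨rfl⟩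

/-- The unitary group is compact, hence it carries a Haar probability measure. -/
instance (q : ℕ) : CompactSpace (TwoQuditUnitary q) := by
  refine isCompact_iff_compactSpace.mp ?_
  have hbox : IsCompact (Set.pi Set.univ fun _ : Fin q × Fin q =>
      Set.pi Set.univ fun _ : Fin q × Fin q => Metric.closedBall (0 : ℂ) 1) :=
    isCompact_univ_pi fun _ => isCompact_univ_pi fun _ => isCompact_closedBall _ _
  refine IsCompact.of_isClosed_subset hbox ?_ ?_
  · exact isClosed_unitary
  · intro U hU i _ j _
    simpa using entry_norm_bound_of_unitary hU i j

/-- The Haar probability measure on `U(q²)`. -/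
def haarProb (q : ℕ) : Measure (TwoQuditUnitary q) :=
  Measure.haarMeasure (⊤ : TopologicalSpace.PositiveCompacts (TwoQuditUnitary q))

/-- `μ` is a unitary 2-design: it is a probability measure and
`E_μ[U ⊗ U ⊗ Ū ⊗ Ū] = E_Haar[U ⊗ U ⊗ Ū ⊗ Ū]`, entry by entry. -/
structure IsTwoDesign {q : ℕ} (μ : Measure (TwoQuditUnitary q)) : Prop where
  isProbabilityMeasure : IsProbabilityMeasure μ
  moment_eq : ∀ a a' b b' c c' d d' : Fin q × Fin q,
    ∫ U, U.1 a a' * U.1 b b' * star (U.1 c c') * star (U.1 d d') ∂μ =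
      ∫ U, U.1 a a' * U.1 b b' * star (U.1 c c') * star (U.1 d d') ∂(haarProb q)

/-! ### Parameterized gates -/

/-- A parameterized gate `θ ↦ W_l e^{-iAθ} W_r` on (at most) two qudits, with `A` Hermitian,
`W_l`, `W_r` fixed unitaries, and `e^{-iAθ}` periodic in `θ` with period `2π`.
A gate on a single qudit is the special case in which `A`, `W_l`, `W_r` act as the identity on the
other tensor factor. -/
structure ParamGate (q : ℕ) where
  A : Matrix (Fin q × Fin q) (Fin q × Fin q) ℂ
  Wl : TwoQuditUnitary q
  Wr : TwoQuditUnitary q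
  isHermitian : A.IsHermitian
  periodic : Function.Periodic
    (fun θ : ℝ => NormedSpace.exp ((-(Complex.I * (θ : ℂ))) • A)) (2 * Real.pi)

/-- The two-qudit operator `W_l e^{-iAθ} W_r`. -/
def ParamGate.eval {q : ℕ} (G : ParamGate q) (θ : ℝ) :
    Matrix (Fin q × Fin q) (Fin q × Fin q) ℂ :=
  G.Wl.1 * NormedSpace.exp ((-(Complex.I * (θ : ℂ))) • G.A) * G.Wr.1

/-! ### Operators on `n` qudits -/

/-- Operators on `n` qudits of local dimension `q`, in the computational basis. -/
abbrev Op (n q : ℕ) : Type := Matrix (Fin n → Fin q) (Fin n → Fin q) ℂ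

/-- The two-qudit operator `B` acting on the sites `i`, `j` (and as the identity elsewhere). -/
def onSites {n q : ℕ} (i j : Fin n) (B : Matrix (Fin q × Fin q) (Fin q × Fin q) ℂ) : Op n q :=
  Matrix.of fun s t =>
    if ∀ k, k ≠ i → k ≠ j → s k = t k then B (s i, s j) (t i, t j) else 0

/-- The product `F (k-1) * ⋯ * F 1 * F 0`: `F 0` is applied first. -/
def timeProd {ι : Type} [Fintype ι] [DecidableEq ι] {k : ℕ} (F : Fin k → Matrix ι ι ℂ) :
    Matrix ι ι ℂ :=
  (List.ofFn F).reverse.prod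

/-- The operator norm on matrices, with respect to the Euclidean norm on vectors. -/
def opNorm {ι : Type} [Fintype ι] [DecidableEq ι] (B : Matrix ι ι ℂ) : ℝ :=
  ‖Matrix.toEuclideanCLM (𝕜 := ℂ) B‖

/-! ### The ansatz -/

/-- An ansatz of the model on `n` qudits of local dimension `q`. It has `m` random entangling
gates; the `t`-th one acts on the distinct sites `site₁ t`, `site₂ t`, is drawn from the 2-design
`law t`, and is preceded by `nPre t` and succeeded by `nPost t` parameterized gates which act on
one or both of these two sites. Every qudit is acted on by some entangling gate. -/
structure Ansatz (n q : ℕ) where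
  m : ℕ
  site₁ : Fin m → Fin n
  site₂ : Fin m → Fin n
  site_ne : ∀ t, site₁ t ≠ site₂ t
  law : Fin m → Measure (TwoQuditUnitary q)
  isTwoDesign : ∀ t, IsTwoDesign (law t)
  nPre : Fin m → ℕ
  nPost : Fin m → ℕ
  pre : ∀ t, Fin (nPre t) → ParamGate q
  post : ∀ t, Fin (nPost t) → ParamGate q
  covered : ∀ k, ∃ t, k = site₁ t ∨ k = site₂ t

namespace Ansatz

variable {n q : ℕ}

/-- The index set of the parameters: one parameter for each parameterized gate. -/
abbrev Param (C : Ansatz n q) : Type :=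
  Σ t : Fin C.m, Fin (C.nPre t) ⊕ Fin (C.nPost t)

/-- A realization of the entangling gates. -/
abbrev Realization (C : Ansatz n q) : Type :=
  Fin C.m → TwoQuditUnitary q

/-- The parameterized gate with a given index. -/
def gate (C : Ansatz n q) : C.Param → ParamGate q
  | ⟨t, Sum.inl a⟩ => C.pre t a
  | ⟨t, Sum.inr b⟩ => C.post t b

/-- The `t`-th entangling gate together with its preceding and succeeding parameterized gates, as
a two-qudit operator. -/
def block (C : Ansatz n q) (V : C.Realization) (θ : C.Param → ℝ) (t : Fin C.m) :
    Matrix (Fin q × Fin q) (Fin q × Fin q) ℂ :=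
  timeProd (fun b => (C.post t b).eval (θ ⟨t, Sum.inr b⟩)) * (V t).1 *
    timeProd (fun a => (C.pre t a).eval (θ ⟨t, Sum.inl a⟩))

/-- The circuit unitary `U_V(θ)`. -/
def circuit (C : Ansatz n q) (V : C.Realization) (θ : C.Param → ℝ) : Op n q :=
  timeProd fun t => onSites (C.site₁ t) (C.site₂ t) (C.block V θ t)

/-- The matrix element `⟨0ⁿ| U_V(θ)† O U_V(θ) |0ⁿ⟩`. -/
def expval [NeZero q] (C : Ansatz n q) (O : Op n q) (V : C.Realization) (θ : C.Param → ℝ) : ℂ :=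
  ((C.circuit V θ)ᴴ * O * C.circuit V θ) (fun _ => 0) (fun _ => 0)

/-- The objective function `f_V(θ) = ⟨0ⁿ| U_V(θ)† H U_V(θ) |0ⁿ⟩`, real since `H` will be
Hermitian. -/
def objective [NeZero q] (C : Ansatz n q) (H : Op n q) (V : C.Realization) (θ : C.Param → ℝ) : ℝ :=
  (C.expval H V θ).re

/-- The partial derivative of `f_V` at `θ` with respect to the parameter `l`. -/
def partialDeriv [NeZero q] (C : Ansatz n q) (H : Op n q) (V : C.Realization)
    (θ : C.Param → ℝ) (l : C.Param) : ℝ :=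
  deriv (fun s => C.objective H V (Function.update θ l s)) (θ l)

/-- `‖∇ f_V(θ)‖²`. -/
def gradNormSq [NeZero q] (C : Ansatz n q) (H : Op n q) (V : C.Realization)
    (θ : C.Param → ℝ) : ℝ :=
  ∑ l, C.partialDeriv H V θ l ^ 2

/-- The law of the entangling gates: they are independent. -/
def gateLaw (C : Ansatz n q) : Measure C.Realization :=
  Measure.pi C.law

/-- The uniform probability distribution on the parameter space `[0, 2π]^p`. -/
def paramLaw (C : Ansatz n q) : Measure (C.Param → ℝ) :=
  Measure.pi fun _ => ProbabilityTheory.cond volume (Set.Icc 0 (2 * Real.pi))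

/-- The average `E_V E_θ F(V, θ)`. -/
def average (C : Ansatz n q) (F : C.Realization → (C.Param → ℝ) → ℝ) : ℝ :=
  ∫ V, ∫ θ, F V θ ∂C.paramLaw ∂C.gateLaw

end Ansatz

/-! ### Operator bases and the coefficients of an observable -/

/-- `M_0, …, M_{q²-1}` is an orthogonal basis of `ℂ^{q × q}` for the Hilbert-Schmidt inner product
with `M_0 = I` and `tr (M_i† M_j) = q δ_{ij}`. -/
structure IsOperatorBasis {q : ℕ} [NeZero q] (M : Fin (q ^ 2) → Matrix (Fin q) (Fin q) ℂ) :
    Prop where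
  zero_eq : M 0 = 1
  trace_eq : ∀ i j, ((M i)ᴴ * M j).trace = if i = j then (q : ℂ) else 0

/-- The tensor product `M_x = M_{x_1} ⊗ ⋯ ⊗ M_{x_n}`. -/
def tensorOp {n q : ℕ} (M : Fin (q ^ 2) → Matrix (Fin q) (Fin q) ℂ) (x : Fin n → Fin (q ^ 2)) :
    Op n q :=
  Matrix.of fun s t => ∏ k, M (x k) (s k) (t k)

/-- The weight `|x|`: the number of nonzero entries of `x`. -/
def weight {n q : ℕ} [NeZero q] (x : Fin n → Fin (q ^ 2)) : ℕ :=
  (Finset.univ.filter fun k => x k ≠ 0).card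

/-- The coefficient `c_x = q^{-n} tr (M_x† H)` of `H` with respect to the operators `M_x`. -/
def coeff {n q : ℕ} (M : Fin (q ^ 2) → Matrix (Fin q) (Fin q) ℂ) (H : Op n q)
    (x : Fin n → Fin (q ^ 2)) : ℂ :=
  ((q : ℂ) ^ n)⁻¹ * ((tensorOp M x)ᴴ * H).trace

/-- `g_x = E_V E_θ |⟨0ⁿ| U_V(θ)† M_x U_V(θ) |0ⁿ⟩|²`. -/
def Ansatz.g {n q : ℕ} [NeZero q] (C : Ansatz n q) (M : Fin (q ^ 2) → Matrix (Fin q) (Fin q) ℂ)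
    (x : Fin n → Fin (q ^ 2)) : ℝ :=
  C.average fun V θ => ‖C.expval (tensorOp M x) V θ‖ ^ 2

end BarrenPlateau

end

noncomputable section

namespace BarrenPlateau

/-!
Let `ρ = |0ⁿ⟩⟨0ⁿ|` and follow the two-copy state `ρ ⊗ ρ` through the circuit, averaged over the
gates. Averaging over a 2-design on two sites turns a product tensor into a nonnegative
combination of product tensors carrying the normalized identity or the normalized swap on those two
sites, and does not increase the weight `∏ₖ (1 + purityₖ)`, which starts at `2ⁿ`. Once every site
has been hit, only products of identities and swaps remain, and `M_x ⊗ M_x†` takes on such a product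
a value of at most `(q / (q + 1))ⁿ q⁻ˡ` times its weight, where `l = |x|`; distinct `x` do not
interfere. Hence `E ⟨O⟩² ≤ (2q / (q + 1))ⁿ ∑ₓ |cₓ|² q^{-|x|}`, and `2q / (q + 1)` is smaller than
`q^{1/2}` by a fixed power of `q`.

Along a single parameter the objective is `2π`-periodic with second derivative at most
`4‖A‖²‖H‖`, so integration by parts bounds the mean square of its derivative by
`4‖A‖²‖H‖ E |f|`, and `E |f| ≤ (E f²)^{1/2}`.
-/

/-! ### Ordered products of unitaries -/

section TimeProd

variable {ι κ : Type} [Fintype ι] [DecidableEq ι] [Fintype κ] [DecidableEq κ] {k : ℕ}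

theorem timeProd_zero (F : Fin 0 → Matrix ι ι ℂ) : timeProd F = 1 := by
  simp [timeProd]

theorem timeProd_succ (F : Fin (k + 1) → Matrix ι ι ℂ) :
    timeProd F = timeProd (fun t => F t.succ) * F 0 := by
  simp [timeProd, List.ofFn_succ]

theorem timeProd_mem_unitaryGroup {F : Fin k → Matrix ι ι ℂ}
    (hF : ∀ t, F t ∈ Matrix.unitaryGroup ι ℂ) : timeProd F ∈ Matrix.unitaryGroup ι ℂ :=
  Submonoid.list_prod_mem _ <| by simpa [List.mem_ofFn] using hF

theorem map_timeProd (φ : Matrix ι ι ℂ →* Matrix κ κ ℂ) (F : Fin k → Matrix ι ι ℂ) :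
    φ (timeProd F) = timeProd fun t => φ (F t) := by
  simp [timeProd, map_list_prod, List.map_ofFn, Function.comp_def]

theorem continuous_timeProd {X : Type*} [TopologicalSpace X] {F : Fin k → X → Matrix ι ι ℂ}
    (hF : ∀ t, Continuous (F t)) : Continuous fun x => timeProd fun t => F t x := by
  induction k with
  | zero => simpa only [timeProd_zero] using continuous_const
  | succ k ih =>
    simp only [timeProd_succ]
    exact (ih fun t => hF t.succ).mul (hF 0)

end TimeProd

section UnitaryTranslate

variable {α ι κ : Type} [Fintype ι] [DecidableEq ι] [Fintype κ] [DecidableEq κ]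
  {E F G : α → Matrix ι ι ℂ} {W : Matrix ι ι ℂ}

/-- The family `F` of matrices arises from the family `E` by multiplication with fixed unitaries
from both sides. A circuit depends in this way on each of its gates. -/
def IsUnitaryTranslate (F E : α → Matrix ι ι ℂ) : Prop :=
  ∃ P ∈ Matrix.unitaryGroup ι ℂ, ∃ Q ∈ Matrix.unitaryGroup ι ℂ, ∀ s, F s = P * E s * Q

theorem IsUnitaryTranslate.trans (hGF : IsUnitaryTranslate G F) (hFE : IsUnitaryTranslate F E) :
    IsUnitaryTranslate G E := by
  obtain ⟨P, hP, Q, hQ, hG⟩ := hGF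
  obtain ⟨P', hP', Q', hQ', hF⟩ := hFE
  exact ⟨P * P', mul_mem hP hP', Q' * Q, mul_mem hQ' hQ, fun s => by
    simp only [hG, hF, mul_assoc]⟩

theorem isUnitaryTranslate_mul_left (hW : W ∈ Matrix.unitaryGroup ι ℂ) :
    IsUnitaryTranslate (fun s => W * E s) E :=
  ⟨W, hW, 1, one_mem _, fun _ => (mul_one _).symm⟩

theorem isUnitaryTranslate_mul_right (hW : W ∈ Matrix.unitaryGroup ι ℂ) :
    IsUnitaryTranslate (fun s => E s * W) E :=
  ⟨1, one_mem _, W, hW, fun _ => by rw [one_mul]⟩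

theorem IsUnitaryTranslate.map (φ : Matrix ι ι ℂ →⋆ₐ[ℂ] Matrix κ κ ℂ)
    (h : IsUnitaryTranslate F E) : IsUnitaryTranslate (fun s => φ (F s)) fun s => φ (E s) := by
  obtain ⟨P, hP, Q, hQ, hF⟩ := h
  exact ⟨φ P, Unitary.map_mem φ hP, φ Q, Unitary.map_mem φ hQ, fun s => by
    simp only [hF, map_mul]⟩

theorem isUnitaryTranslate_timeProd {k : ℕ} {F : Fin k → α → Matrix ι ι ℂ} (t : Fin k) (s₀ : α)
    (hF : ∀ u, F u s₀ ∈ Matrix.unitaryGroup ι ℂ) (hconst : ∀ u ≠ t, ∀ s, F u s = F u s₀) :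
    IsUnitaryTranslate (fun s => timeProd fun u => F u s) (F t) := by
  induction k with
  | zero => exact t.elim0
  | succ k ih =>
    simp only [timeProd_succ]
    cases t using Fin.cases with
    | zero =>
      have htail : ∀ s, (fun u : Fin k => F u.succ s) = fun u => F u.succ s₀ := fun s =>
        funext fun u => hconst _ (Fin.succ_ne_zero u) s
      simp only [htail]
      exact isUnitaryTranslate_mul_left (timeProd_mem_unitaryGroup fun u => hF u.succ)
    | succ t =>
      simp only [hconst 0 (Fin.succ_ne_zero t).symm]
      exact (isUnitaryTranslate_mul_right (hF 0)).trans <| ih t (fun u => hF u.succ)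
        fun u hu => hconst _ ((Fin.succ_injective k).ne hu)

end UnitaryTranslate

/-! ### Operators on two sites -/

section UpdatePair

variable {ι α : Type*} [DecidableEq ι] {i j k : ι}

/-- The function `f` with its values at `i` and `j` replaced: what a two-site operator does to a
configuration, and a two-site gate to the labels of a product tensor. -/
def updatePair (i j : ι) (f : ι → α) (p : α × α) : ι → α :=
  Function.update (Function.update f i p.1) j p.2

theorem updatePair_left (hij : i ≠ j) (f : ι → α) (p : α × α) : updatePair i j f p i = p.1 := by
  simp [updatePair, hij]

theorem updatePair_right (i j : ι) (f : ι → α) (p : α × α) : updatePair i j f p j = p.2 := by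
  simp [updatePair]

theorem updatePair_of_ne (hi : k ≠ i) (hj : k ≠ j) (f : ι → α) (p : α × α) :
    updatePair i j f p k = f k := by
  simp [updatePair, hi, hj]

theorem eq_updatePair_iff (hij : i ≠ j) (f g : ι → α) (p : α × α) :
    g = updatePair i j f p ↔ (∀ k, k ≠ i → k ≠ j → f k = g k) ∧ p = (g i, g j) := by
  simp only [updatePair, Function.eq_update_iff, Prod.ext_iff]
  grind

theorem prod_eq_mul_mul_prod_compl {β : Type*} [Fintype ι] [CommMonoid β] (hij : i ≠ j)
    (g : ι → β) : ∏ k, g k = g i * g j * ∏ k ∈ {i, j}ᶜ, g k := by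
  rw [← Finset.prod_pair hij, Finset.prod_mul_prod_compl]

theorem prod_updatePair {β : Type*} [Fintype ι] [CommMonoid β] (hij : i ≠ j) (F : ι → α → β)
    (f : ι → α) (p : α × α) : ∏ k, F k (updatePair i j f p k) =
      F i p.1 * F j p.2 * ∏ k ∈ {i, j}ᶜ, F k (f k) := by
  rw [prod_eq_mul_mul_prod_compl hij, updatePair_left hij, updatePair_right]
  congr 1
  refine Finset.prod_congr rfl fun k hk => ?_
  obtain ⟨hi, hj⟩ : k ≠ i ∧ k ≠ j := by simpa using hk
  rw [updatePair_of_ne hi hj]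

end UpdatePair

section OnSites

variable {n q : ℕ} {i j : Fin n}

theorem onSites_apply (i j : Fin n) (B : Matrix (Fin q × Fin q) (Fin q × Fin q) ℂ)
    (s t : Fin n → Fin q) : onSites i j B s t =
      if ∀ k, k ≠ i → k ≠ j → s k = t k then B (s i, s j) (t i, t j) else 0 := rfl

theorem onSites_mulVec (hij : i ≠ j) (B : Matrix (Fin q × Fin q) (Fin q × Fin q) ℂ)
    (v : (Fin n → Fin q) → ℂ) (s : Fin n → Fin q) :
    (onSites i j B *ᵥ v) s = ∑ p, B (s i, s j) p * v (updatePair i j s p) := by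
  have hpick : ∀ p, B (s i, s j) p * v (updatePair i j s p) =
      ∑ t, if t = updatePair i j s p then B (s i, s j) p * v t else 0 := fun p => by simp
  simp only [hpick]
  rw [Finset.sum_comm]
  refine Finset.sum_congr rfl fun t _ => ?_
  simp only [eq_updatePair_iff hij, onSites_apply]
  by_cases ht : ∀ k, k ≠ i → k ≠ j → s k = t k
  · simp [if_pos ht, and_iff_right ht]
  · simp [ht]

theorem onSites_mul (hij : i ≠ j) (B C : Matrix (Fin q × Fin q) (Fin q × Fin q) ℂ) :
    onSites i j (B * C) = onSites i j B * onSites i j C := by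
  ext s t
  have hagree : ∀ p, (∀ k, k ≠ i → k ≠ j → updatePair i j s p k = t k) ↔
      ∀ k, k ≠ i → k ≠ j → s k = t k := fun p =>
    forall₃_congr fun k hi hj => by rw [updatePair_of_ne hi hj]
  change _ = (onSites i j B *ᵥ fun u => onSites i j C u t) s
  simp only [onSites_mulVec hij, onSites_apply, hagree, updatePair_left hij, updatePair_right]
  split_ifs
  · rw [Matrix.mul_apply]
  · simp

theorem onSites_one (i j : Fin n) :
    onSites i j (1 : Matrix (Fin q × Fin q) (Fin q × Fin q) ℂ) = 1 := by
  ext s t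
  have hst : s = t ↔ (∀ k, k ≠ i → k ≠ j → s k = t k) ∧ (s i, s j) = (t i, t j) := by
    simp only [funext_iff, Prod.mk.injEq]
    grind
  rw [onSites_apply, Matrix.one_apply, Matrix.one_apply, ← ite_and]
  exact if_congr hst.symm rfl rfl

theorem onSites_conjTranspose (i j : Fin n) (B : Matrix (Fin q × Fin q) (Fin q × Fin q) ℂ) :
    onSites i j Bᴴ = (onSites i j B)ᴴ := by
  ext s t
  simp only [Matrix.conjTranspose_apply, onSites_apply, eq_comm (a := s _)]
  split_ifs <;> simp

theorem onSites_add (i j : Fin n) (B C : Matrix (Fin q × Fin q) (Fin q × Fin q) ℂ) :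
    onSites i j (B + C) = onSites i j B + onSites i j C := by
  ext s t
  simp only [Matrix.add_apply, onSites_apply]
  split_ifs <;> simp

theorem onSites_smul (i j : Fin n) (c : ℂ) (B : Matrix (Fin q × Fin q) (Fin q × Fin q) ℂ) :
    onSites i j (c • B) = c • onSites i j B := by
  ext s t
  simp only [Matrix.smul_apply, onSites_apply]
  split_ifs <;> simp

/-- The embedding of the two-site operators on the sites `i`, `j`, as a homomorphism of
star algebras. -/
def onSitesHom (hij : i ≠ j) : Matrix (Fin q × Fin q) (Fin q × Fin q) ℂ →⋆ₐ[ℂ] Op n q where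
  toFun := onSites i j
  map_one' := onSites_one i j
  map_mul' := onSites_mul hij
  map_zero' := by simpa using onSites_smul i j 0 (0 : Matrix (Fin q × Fin q) (Fin q × Fin q) ℂ)
  map_add' := onSites_add i j
  commutes' c := by
    rw [Algebra.algebraMap_eq_smul_one, Algebra.algebraMap_eq_smul_one, onSites_smul, onSites_one]
  map_star' := onSites_conjTranspose i j

theorem onSites_mem_unitaryGroup (hij : i ≠ j) {B : Matrix (Fin q × Fin q) (Fin q × Fin q) ℂ}
    (hB : B ∈ Matrix.unitaryGroup (Fin q × Fin q) ℂ) :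
    onSites i j B ∈ Matrix.unitaryGroup (Fin n → Fin q) ℂ :=
  Unitary.map_mem (onSitesHom hij) hB

theorem continuous_onSites (i j : Fin n) :
    Continuous (onSites i j : Matrix (Fin q × Fin q) (Fin q × Fin q) ℂ → Op n q) := by
  refine continuous_matrix fun s t => ?_
  simp only [onSites_apply]
  split_ifs
  · exact continuous_id.matrix_elem _ _
  · exact continuous_const

end OnSites

/-! ### Tensors with two upper and two lower indices -/

section Lift

variable {ι : Type}

/-- Indices of the tensors in `ℂ^ι ⊗ ℂ^ι ⊗ (ℂ^ι)* ⊗ (ℂ^ι)*`. -/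
abbrev Quad (ι : Type) : Type := ι × ι × ι × ι

/-- Tensors in `ℂ^ι ⊗ ℂ^ι ⊗ (ℂ^ι)* ⊗ (ℂ^ι)*`, the space of operators on two copies of `ℂ^ι`. -/
abbrev Tensor4 (ι : Type) : Type := Quad ι → ℂ

variable [Fintype ι] [DecidableEq ι]

open scoped Kronecker in
/-- The homomorphism `B ↦ B ⊗ B ⊗ B̄ ⊗ B̄`, which governs the second moments of `B`. -/
def lift4 : Matrix ι ι ℂ →* Matrix (Quad ι) (Quad ι) ℂ where
  toFun B := B ⊗ₖ (B ⊗ₖ (B.map (starRingEnd ℂ) ⊗ₖ B.map (starRingEnd ℂ)))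
  map_one' := by simp
  map_mul' A B := by simp only [Matrix.map_mul, Matrix.mul_kronecker_mul]

theorem lift4_apply (B : Matrix ι ι ℂ) (e f : Quad ι) :
    lift4 B e f = B e.1 f.1 * B e.2.1 f.2.1 * star (B e.2.2.1 f.2.2.1) *
      star (B e.2.2.2 f.2.2.2) := by
  simp [lift4, Matrix.kroneckerMap_apply, mul_assoc]

theorem continuous_lift4 : Continuous (lift4 : Matrix ι ι ℂ → _) := by
  refine continuous_matrix fun e f => ?_
  simp only [lift4_apply]
  have hentry : ∀ i j, Continuous fun B : Matrix ι ι ℂ => B i j := fun i j =>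
    continuous_id.matrix_elem i j
  exact (((hentry _ _).mul (hentry _ _)).mul (hentry _ _).star).mul (hentry _ _).star

end Lift

section PermTensor

variable {ι : Type}

/-- The indices at which `permTensor b` does not vanish. -/
def permQuad (b : Bool) (p : ι × ι) : Quad ι := (p.1, p.2, bif b then p.swap else p)

variable [DecidableEq ι]

/-- The operators on `ℂ^ι ⊗ ℂ^ι` which permute the two factors, as tensors: `false` stands for the
identity and `true` for the swap. -/
def permTensor (b : Bool) : Tensor4 ι := fun e => if e = permQuad b (e.1, e.2.1) then 1 else 0

theorem permTensor_apply (b : Bool) (i j : ι) (p : ι × ι) :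
    permTensor b (i, j, p) = if p = bif b then (j, i) else (i, j) then 1 else 0 := by
  simp [permTensor, permQuad]

variable [Fintype ι]

theorem permTensor_dotProduct (b : Bool) (y : Tensor4 ι) :
    permTensor b ⬝ᵥ y = ∑ p, y (permQuad b p) := by
  rw [dotProduct, Fintype.sum_prod_type, Fintype.sum_prod_type]
  refine Finset.sum_congr rfl fun i _ => ?_
  rw [Fintype.sum_prod_type]
  simp [permTensor_apply, permQuad]

theorem permTensor_dotProduct_permTensor (b b' : Bool) :
    (permTensor b : Tensor4 ι) ⬝ᵥ permTensor b' =
      if b = b' then (Fintype.card ι : ℂ) ^ 2 else Fintype.card ι := by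
  rw [permTensor_dotProduct, Fintype.sum_prod_type]
  cases b <;> cases b' <;> simp [permTensor_apply, permQuad, sq, eq_comm]

theorem sum_mul_star_of_mem_unitaryGroup {U : Matrix ι ι ℂ} (hU : U ∈ Matrix.unitaryGroup ι ℂ)
    (f g : ι) : ∑ e, U e f * star (U e g) = if f = g then 1 else 0 := by
  have h := congrFun₂ (Matrix.mem_unitaryGroup_iff'.mp hU) g f
  simpa only [Matrix.mul_apply, Matrix.one_apply, Matrix.star_apply, mul_comm (star _),
    eq_comm (a := g)] using h

theorem permTensor_vecMul_lift4 {U : Matrix ι ι ℂ} (hU : U ∈ Matrix.unitaryGroup ι ℂ) (b : Bool) :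
    permTensor b ᵥ* lift4 U = permTensor b := by
  funext ⟨f₁, f₂, g⟩
  have hfac : permTensor b (f₁, f₂, g) =
      (∑ e, U e f₁ * star (U e (bif b then g.swap else g).1)) *
        ∑ e, U e f₂ * star (U e (bif b then g.swap else g).2) := by
    rw [sum_mul_star_of_mem_unitaryGroup hU, sum_mul_star_of_mem_unitaryGroup hU]
    cases b <;> simp [permTensor, permQuad, Prod.ext_iff] <;> grind
  rw [hfac, Finset.sum_mul_sum, ← Fintype.sum_prod_type']
  refine (permTensor_dotProduct b _).trans (Finset.sum_congr rfl fun p _ => ?_)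
  cases b <;> simp only [lift4_apply, permQuad, cond_true, cond_false, Prod.fst_swap,
    Prod.snd_swap] <;> ring

end PermTensor

/-! ### Tensors invariant under all `U ⊗ U ⊗ Ū ⊗ Ū` -/

section Invariant

variable {ι : Type}

theorem exists_perm_apply_eq_apply_eq {a b c d : ι} (hab : a ≠ b) (hcd : c ≠ d) :
    ∃ σ : Equiv.Perm ι, σ a = c ∧ σ b = d := by
  classical
  have hne : c ≠ Equiv.swap a c b := fun h =>
    hab <| (Equiv.swap a c).injective ((Equiv.swap_apply_left a c).trans h)
  refine ⟨Equiv.swap (Equiv.swap a c b) d * Equiv.swap a c, ?_, ?_⟩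
  · rw [Equiv.Perm.mul_apply, Equiv.swap_apply_left, Equiv.swap_apply_of_ne_of_ne hne hcd]
  · rw [Equiv.Perm.mul_apply, Equiv.swap_apply_left]

variable [Fintype ι] [DecidableEq ι] {y : Tensor4 ι} {a b c d : ι}

/-- The tensor `y` is fixed by `U ⊗ U ⊗ Ū ⊗ Ū` for every unitary `U`. -/
def IsUnitaryInvariant (y : Tensor4 ι) : Prop :=
  ∀ U ∈ Matrix.unitaryGroup ι ℂ, lift4 U *ᵥ y = y

open scoped Kronecker in
-- Read as an operator on two copies of `ℂ^ι`, the tensor `y` commutes with `U ⊗ U`.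
theorem IsUnitaryInvariant.commute (hy : IsUnitaryInvariant y) {U : Matrix ι ι ℂ}
    (hU : U ∈ Matrix.unitaryGroup ι ℂ) (a b c d : ι) :
    ∑ f, ∑ g, U a f * U b g * y (f, g, c, d) = ∑ f, ∑ g, U f c * U g d * y (a, b, f, g) := by
  have hUU : Uᵀ * U.map (starRingEnd ℂ) = 1 := by
    ext f g
    simpa [Matrix.mul_apply, Matrix.one_apply] using sum_mul_star_of_mem_unitaryGroup hU f g
  have h : ((1 : Matrix ι ι ℂ) ⊗ₖ ((1 : Matrix ι ι ℂ) ⊗ₖ (Uᵀ ⊗ₖ Uᵀ))) *ᵥ y =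
      (U ⊗ₖ (U ⊗ₖ ((1 : Matrix ι ι ℂ) ⊗ₖ (1 : Matrix ι ι ℂ)))) *ᵥ y := by
    conv_lhs => rw [← hy U hU, Matrix.mulVec_mulVec, lift4]
    simp only [MonoidHom.coe_mk, OneHom.coe_mk, ← Matrix.mul_kronecker_mul, hUU, Matrix.one_mul]
  have h' := congrFun h (a, b, c, d)
  simp only [Matrix.mulVec, dotProduct, Fintype.sum_prod_type, Matrix.kroneckerMap_apply,
    Matrix.one_apply, Matrix.transpose_apply] at h'
  simpa [mul_assoc, Finset.sum_ite_eq, ← Finset.mul_sum] using h'.symm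

theorem IsUnitaryInvariant.mul_eq_mul_of_ne_zero (hy : IsUnitaryInvariant y) {u : ι → ℂ}
    (hu : ∀ z, u z * star (u z) = 1) (h0 : y (a, b, c, d) ≠ 0) : u a * u b = u c * u d := by
  have hU : Matrix.diagonal u ∈ Matrix.unitaryGroup ι ℂ := by
    rw [Matrix.mem_unitaryGroup_iff, Matrix.star_eq_conjTranspose,
      Matrix.diagonal_conjTranspose, Matrix.diagonal_mul_diagonal, ← Matrix.diagonal_one]
    exact congrArg Matrix.diagonal (funext hu)
  have h := hy.commute hU a b c d
  simp only [Matrix.diagonal_apply, mul_ite, ite_mul, mul_zero, zero_mul, Finset.sum_ite_eq,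
    Finset.sum_ite_eq', Finset.mem_univ, if_true] at h
  exact mul_right_cancel₀ h0 h

theorem IsUnitaryInvariant.support (hy : IsUnitaryInvariant y) (h0 : y (a, b, c, d) ≠ 0) :
    a = c ∧ b = d ∨ a = d ∧ b = c := by
  -- The diagonal unitary with a single entry `i` counts how often `z` occurs in a pair.
  have hcount : ∀ z, (if a = z then Complex.I else 1) * (if b = z then Complex.I else 1) =
      (if c = z then Complex.I else 1) * (if d = z then Complex.I else 1) := fun z =>
    hy.mul_eq_mul_of_ne_zero (u := fun w => if w = z then Complex.I else 1)
      (fun w => by split_ifs <;> simp) h0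
  have hI : Complex.I ≠ 1 := fun h => by simpa using congrArg Complex.re h
  have hneg : (-1 : ℂ) ≠ 1 := by norm_num
  have hnegI : (-1 : ℂ) ≠ Complex.I := fun h => by simpa using congrArg Complex.im h
  have ha := hcount a
  have hb := hcount b
  by_cases hab : a = b <;> by_cases hac : a = c <;> by_cases had : a = d <;>
    by_cases hbc : b = c <;> by_cases hbd : b = d <;> simp_all [eq_comm]

theorem IsUnitaryInvariant.apply_perm (hy : IsUnitaryInvariant y) (σ : Equiv.Perm ι)
    (a b c d : ι) : y (σ a, σ b, σ c, σ d) = y (a, b, c, d) := by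
  have hU : σ.permMatrix ℂ ∈ Matrix.unitaryGroup ι ℂ := by
    rw [Matrix.mem_unitaryGroup_iff, Matrix.star_eq_conjTranspose, Matrix.conjTranspose_permMatrix,
      ← Matrix.permMatrix_mul]
    simp
  have h := hy.commute hU a b (σ c) (σ d)
  simpa [Equiv.Perm.permMatrix, PEquiv.toMatrix_apply, Equiv.toPEquiv_apply] using h

theorem smul_one_add_smul_mem_unitaryGroup {S : Matrix ι ι ℂ} (hS : S.IsHermitian)
    (hSS : S * S = 1) {r s : ℝ} (hrs : r ^ 2 + s ^ 2 = 1) :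
    (r : ℂ) • 1 + (s * Complex.I) • S ∈ Matrix.unitaryGroup ι ℂ := by
  have hrs' : (r : ℂ) ^ 2 + (s : ℂ) ^ 2 = 1 := by exact_mod_cast hrs
  rw [Matrix.mem_unitaryGroup_iff, Matrix.star_eq_conjTranspose]
  simp only [Matrix.conjTranspose_add, Matrix.conjTranspose_smul, hS.eq, Matrix.conjTranspose_one,
    add_mul, mul_add, smul_mul_assoc, mul_smul_comm, hSS, one_mul, mul_one, star_mul',
    RCLike.star_def, Complex.conj_ofReal, Complex.conj_I]
  match_scalars
  · linear_combination hrs' - (s : ℂ) ^ 2 * Complex.I_sq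
  · ring

theorem exists_unitary_row_eq (a b : ι) : ∃ U ∈ Matrix.unitaryGroup ι ℂ,
    U a = Pi.single a (3 / 5) + Pi.single b (4 / 5 * Complex.I) := by
  have hS : ((Equiv.swap a b).permMatrix ℂ).IsHermitian := by
    rw [Matrix.IsHermitian, Matrix.conjTranspose_permMatrix, Equiv.swap_inv]
  have hSS : (Equiv.swap a b).permMatrix ℂ * (Equiv.swap a b).permMatrix ℂ = 1 := by
    rw [← Matrix.permMatrix_mul]
    simp
  refine ⟨_, smul_one_add_smul_mem_unitaryGroup hS hSS (r := 3 / 5) (s := 4 / 5) (by norm_num), ?_⟩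
  funext f
  simp [Equiv.Perm.permMatrix, PEquiv.toMatrix_apply, Equiv.toPEquiv_apply, Matrix.one_apply,
    Pi.single_apply, eq_comm]

theorem IsUnitaryInvariant.apply_diag (hy : IsUnitaryInvariant y) (hab : a ≠ b) :
    y (a, a, a, a) = y (a, b, a, b) + y (b, a, a, b) := by
  obtain ⟨U, hU, hUa⟩ := exists_unitary_row_eq a b
  have hrow : ∀ g : ι → ℂ, ∑ f, U a f * g f = 3 / 5 * g a + 4 / 5 * Complex.I * g b := fun g => by
    simp [hUa, add_mul, Finset.sum_add_distrib, Pi.single_apply]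
  have hzero : ∀ {c d e f}, ¬(c = e ∧ d = f ∨ c = f ∧ d = e) → y (c, d, e, f) = 0 :=
    not_imp_comm.mp hy.support
  have hleft : ∑ f, ∑ g, U a f * U a g * y (f, g, a, b) =
      12 / 25 * Complex.I * (y (a, b, a, b) + y (b, a, a, b)) := by
    simp only [mul_assoc, ← Finset.mul_sum]
    rw [hrow, hrow, hrow, hzero (c := a) (d := a) (by tauto), hzero (c := b) (d := b) (by tauto)]
    ring
  have hright : ∑ f, ∑ g, U f a * U g b * y (a, a, f, g) =
      12 / 25 * Complex.I * y (a, a, a, a) := by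
    rw [Finset.sum_eq_single a, Finset.sum_eq_single a]
    · rw [hUa]
      simp only [Pi.add_apply, Pi.single_eq_same, Pi.single_eq_of_ne hab,
        Pi.single_eq_of_ne hab.symm]
      ring
    · exact fun g _ hg => by rw [hzero (by tauto), mul_zero]
    · simp
    · exact fun f _ hf => Finset.sum_eq_zero fun g _ => by rw [hzero (by tauto), mul_zero]
    · simp
  have h := hy.commute hU a a a b
  rw [hleft, hright] at h
  exact (mul_left_cancel₀ (by simp) h).symm

theorem IsUnitaryInvariant.eq_smul_add_smul (hy : IsUnitaryInvariant y) (hab : a ≠ b) :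
    y = y (a, b, a, b) • permTensor false + y (b, a, a, b) • permTensor true := by
  funext ⟨c, d, e, f⟩
  simp only [Pi.add_apply, Pi.smul_apply, smul_eq_mul, permTensor]
  by_cases hsupp : c = e ∧ d = f ∨ c = f ∧ d = e
  · by_cases hcd : c = d
    · obtain ⟨rfl, rfl, rfl⟩ : c = d ∧ c = e ∧ c = f := by grind
      simpa [permQuad, hy.apply_diag hab] using hy.apply_perm (Equiv.swap a c) a a a a
    · rcases hsupp with ⟨rfl, rfl⟩ | ⟨rfl, rfl⟩
      · obtain ⟨σ, rfl, rfl⟩ := exists_perm_apply_eq_apply_eq hab hcd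
        simp [permQuad, hy.apply_perm, hab]
      · obtain ⟨σ, rfl, rfl⟩ := exists_perm_apply_eq_apply_eq hab.symm hcd
        simp [permQuad, hy.apply_perm, hab.symm]
  · have h0 : y (c, d, e, f) = 0 := not_imp_comm.mp hy.support hsupp
    have hne : ∀ e', (c, d, e, f) ≠ permQuad e' (c, d) := by
      simp only [permQuad, ne_eq, Prod.ext_iff]
      grind
    simp only [h0, if_neg (hne _), mul_zero, add_zero]

/-- The coefficient of `permTensor b` in the projection of `y` to the invariant tensors, by
Weingarten's formula for two copies. -/
def weingartenCoeff (y : Tensor4 ι) (b : Bool) : ℂ :=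
  (Fintype.card ι * (permTensor b ⬝ᵥ y) - permTensor (!b) ⬝ᵥ y) /
    (Fintype.card ι * ((Fintype.card ι : ℂ) ^ 2 - 1))

theorem weingartenCoeff_sum_smul [Nontrivial ι] (α : Bool → ℂ) (b : Bool) :
    weingartenCoeff (∑ b, α b • permTensor b : Tensor4 ι) b = α b := by
  have hN : (Fintype.card ι : ℂ) ≠ 0 := by simp
  have hN2 : (Fintype.card ι : ℂ) ^ 2 - 1 ≠ 0 := by
    have : Fintype.card ι ^ 2 ≠ 1 := (Nat.one_lt_pow two_ne_zero Fintype.one_lt_card).ne'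
    exact sub_ne_zero.mpr (by exact_mod_cast this)
  simp only [weingartenCoeff, dotProduct_add, dotProduct_smul, permTensor_dotProduct_permTensor,
    smul_eq_mul, Fintype.sum_bool]
  cases b <;> simp <;> field_simp <;> ring

theorem IsUnitaryInvariant.eq_sum_weingartenCoeff [Nontrivial ι] (hy : IsUnitaryInvariant y) :
    y = ∑ b, weingartenCoeff y b • permTensor b := by
  obtain ⟨a, b, hab⟩ := exists_pair_ne ι
  obtain ⟨α, hα⟩ : ∃ α : Bool → ℂ, y = ∑ e, α e • permTensor e :=
    ⟨fun e => bif e then y (b, a, a, b) else y (a, b, a, b), by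
      simpa [add_comm] using hy.eq_smul_add_smul hab⟩
  simp only [hα, weingartenCoeff_sum_smul]

end Invariant

/-! ### Expectations of random matrices -/

section Expectation

variable {Ω : Type*} [MeasurableSpace Ω] {ι κ τ : Type}

/-- The expectation of a random matrix, taken entrywise so that no norm on matrices has to be
chosen. -/
def expect (μ : Measure Ω) (F : Ω → Matrix ι κ ℂ) : Matrix ι κ ℂ :=
  Matrix.of fun i j => ∫ ω, F ω i j ∂μ

theorem expect_apply (μ : Measure Ω) (F : Ω → Matrix ι κ ℂ) (i : ι) (j : κ) :
    expect μ F i j = ∫ ω, F ω i j ∂μ := rfl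

variable {μ : Measure Ω} {F : Ω → Matrix ι κ ℂ}

theorem expect_mul_left [Fintype ι] (hF : ∀ i j, Integrable (fun ω => F ω i j) μ)
    (A : Matrix τ ι ℂ) : expect μ (fun ω => A * F ω) = A * expect μ F := by
  ext i j
  simp only [expect_apply, Matrix.mul_apply]
  rw [integral_finsetSum _ fun k _ => (hF k j).const_mul _]
  exact Finset.sum_congr rfl fun k _ => integral_const_mul _ _

theorem expect_mul_right [Fintype κ] (hF : ∀ i j, Integrable (fun ω => F ω i j) μ)
    (A : Matrix κ τ ℂ) : expect μ (fun ω => F ω * A) = expect μ F * A := by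
  ext i j
  simp only [expect_apply, Matrix.mul_apply]
  rw [integral_finsetSum _ fun k _ => (hF i k).mul_const _]
  exact Finset.sum_congr rfl fun k _ => integral_mul_const _ _

theorem expect_mulVec [Fintype κ] (hF : ∀ i j, Integrable (fun ω => F ω i j) μ)
    (x : κ → ℂ) (i : ι) : (expect μ F *ᵥ x) i = ∫ ω, (F ω *ᵥ x) i ∂μ := by
  simp only [expect_apply, Matrix.mulVec, dotProduct]
  rw [integral_finsetSum _ fun k _ => (hF i k).mul_const _]
  exact Finset.sum_congr rfl fun k _ => (integral_mul_const _ _).symm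

theorem vecMul_expect [Fintype ι] (hF : ∀ i j, Integrable (fun ω => F ω i j) μ)
    (w : ι → ℂ) (j : κ) : (w ᵥ* expect μ F) j = ∫ ω, (w ᵥ* F ω) j ∂μ := by
  simp only [expect_apply, Matrix.vecMul, dotProduct]
  rw [integral_finsetSum _ fun k _ => (hF k j).const_mul _]
  exact Finset.sum_congr rfl fun k _ => (integral_const_mul _ _).symm

theorem dotProduct_expect_mulVec [Fintype ι] [Fintype κ]
    (hF : ∀ i j, Integrable (fun ω => F ω i j) μ) (w : ι → ℂ) (x : κ → ℂ) :
    w ⬝ᵥ (expect μ F *ᵥ x) = ∫ ω, w ⬝ᵥ (F ω *ᵥ x) ∂μ := by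
  have hint : ∀ i, Integrable (fun ω => (F ω *ᵥ x) i) μ := fun i =>
    integrable_finsetSum _ fun j _ => (hF i j).mul_const _
  simp only [dotProduct, expect_mulVec hF]
  rw [integral_finsetSum _ fun i _ => (hint i).const_mul _]
  exact Finset.sum_congr rfl fun i _ => (integral_const_mul _ _).symm

theorem integrable_entry_of_continuous [TopologicalSpace Ω] [CompactSpace Ω]
    [OpensMeasurableSpace Ω] [IsFiniteMeasure μ] (hF : Continuous F) (i : ι) (j : κ) :
    Integrable (fun ω => F ω i j) μ :=
  (hF.matrix_elem i j).integrable_of_hasCompactSupport (.of_compactSpace _)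

end Expectation

section Independence

variable {ι Ω : Type} [Fintype ι] [DecidableEq ι] [MeasurableSpace Ω] {k : ℕ}
  {μ : Fin k → Measure Ω} [∀ t, IsProbabilityMeasure (μ t)] {F : Fin k → Ω → Matrix ι ι ℂ}

theorem timeProd_comp_piFinSucc (F : Fin (k + 1) → Ω → Matrix ι ι ℂ) (i j : ι) :
    (fun V : Fin (k + 1) → Ω => timeProd (fun t => F t (V t)) i j) =
      (fun p : Ω × (Fin k → Ω) => ∑ l, F 0 p.1 l j * timeProd (fun t => F t.succ (p.2 t)) i l) ∘
        MeasurableEquiv.piFinSuccAbove (fun _ => Ω) 0 := by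
  funext V
  simp only [timeProd_succ, Matrix.mul_apply]
  exact Finset.sum_congr rfl fun l _ => mul_comm _ _

theorem integrable_timeProd (hF : ∀ t i j, Integrable (fun ω => F t ω i j) (μ t)) (i j : ι) :
    Integrable (fun V : Fin k → Ω => timeProd (fun t => F t (V t)) i j) (Measure.pi μ) := by
  induction k generalizing i j with
  | zero => simpa only [timeProd_zero] using integrable_const _
  | succ k ih =>
    rw [timeProd_comp_piFinSucc]
    exact (measurePreserving_piFinSuccAbove μ 0).integrable_comp_of_integrable <|
      integrable_finsetSum _ fun l _ => (hF 0 l j).mul_prod (ih (fun t => hF t.succ) i l)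

theorem expect_timeProd (hF : ∀ t i j, Integrable (fun ω => F t ω i j) (μ t)) :
    expect (Measure.pi μ) (fun V => timeProd fun t => F t (V t)) =
      timeProd fun t => expect (μ t) (F t) := by
  induction k with
  | zero =>
    ext i j
    simp [timeProd_zero, expect_apply]
  | succ k ih =>
    ext i j
    have hint : ∀ l, Integrable (fun p : Ω × (Fin k → Ω) =>
        F 0 p.1 l j * timeProd (fun t => F t.succ (p.2 t)) i l)
        ((μ 0).prod (Measure.pi fun t => μ (Fin.succ t))) := fun l =>
      (hF 0 l j).mul_prod (integrable_timeProd (fun t => hF t.succ) i l)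
    rw [timeProd_succ, ← ih fun t => hF t.succ, Matrix.mul_apply, expect_apply,
      timeProd_comp_piFinSucc]
    refine ((measurePreserving_piFinSuccAbove μ 0).integral_comp' fun p : Ω × (Fin k → Ω) =>
      ∑ l, F 0 p.1 l j * timeProd (fun t => F t.succ (p.2 t)) i l).trans ?_
    refine (integral_finsetSum _ fun l _ => hint l).trans (Finset.sum_congr rfl fun l _ => ?_)
    rw [mul_comm]
    exact integral_prod_mul (fun ω => F 0 ω l j)
      fun V : Fin k → Ω => timeProd (fun t => F t.succ (V t)) i l

end Independence

/-! ### The twirl by a unitary 2-design -/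

section Twirl

variable {q : ℕ} {μ : Measure (TwoQuditUnitary q)}

instance : IsProbabilityMeasure (haarProb q) := by
  constructor
  simpa [haarProb] using
    Measure.haarMeasure_self (K₀ := (⊤ : TopologicalSpace.PositiveCompacts (TwoQuditUnitary q)))

instance : (haarProb q).IsMulLeftInvariant := by
  unfold haarProb
  infer_instance


theorem integrable_lift4 [IsFiniteMeasure μ] (e f : Quad (Fin q × Fin q)) :
    Integrable (fun V : TwoQuditUnitary q => lift4 V.1 e f) μ :=
  integrable_entry_of_continuous (continuous_lift4.comp continuous_subtype_val) e f

theorem lift4_mul_expect_haarProb {P : Matrix (Fin q × Fin q) (Fin q × Fin q) ℂ}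
    (hP : P ∈ Matrix.unitaryGroup (Fin q × Fin q) ℂ) :
    lift4 P * expect (haarProb q) (fun V => lift4 V.1) =
      expect (haarProb q) (fun V => lift4 V.1) := by
  rw [← expect_mul_left integrable_lift4]
  ext e f
  simp only [expect_apply, ← map_mul]
  exact integral_mul_left_eq_self (μ := haarProb q)
    (fun V : TwoQuditUnitary q => lift4 V.1 e f) (⟨P, hP⟩ : TwoQuditUnitary q)

theorem permTensor_vecMul_expect_lift4 [IsProbabilityMeasure μ] (b : Bool) :
    permTensor b ᵥ* expect μ (fun V => lift4 V.1) = permTensor b := by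
  funext e
  rw [vecMul_expect integrable_lift4]
  simp only [permTensor_vecMul_lift4 (Subtype.property _)]
  simp

variable {P Q : Matrix (Fin q × Fin q) (Fin q × Fin q) ℂ}

theorem IsTwoDesign.expect_lift4_mul_mul (hμ : IsTwoDesign μ)
    (hP : P ∈ Matrix.unitaryGroup (Fin q × Fin q) ℂ) :
    expect μ (fun V => lift4 (P * V.1 * Q)) =
      expect (haarProb q) (fun V => lift4 V.1) * lift4 Q := by
  have := hμ.isProbabilityMeasure
  have hhaar : expect μ (fun V => lift4 V.1) = expect (haarProb q) (fun V => lift4 V.1) := by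
    ext e f
    simp only [expect_apply, lift4_apply]
    exact hμ.moment_eq _ _ _ _ _ _ _ _
  have hint : ∀ e f, Integrable (fun V : TwoQuditUnitary q => (lift4 P * lift4 V.1) e f) μ :=
    integrable_entry_of_continuous <|
      continuous_const.mul (continuous_lift4.comp continuous_subtype_val)
  simp only [map_mul]
  rw [expect_mul_right hint, expect_mul_left integrable_lift4, hhaar,
    lift4_mul_expect_haarProb hP]

theorem IsTwoDesign.expect_lift4_mulVec [Nontrivial (Fin q)] (hμ : IsTwoDesign μ)
    (hP : P ∈ Matrix.unitaryGroup (Fin q × Fin q) ℂ)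
    (hQ : Q ∈ Matrix.unitaryGroup (Fin q × Fin q) ℂ) (x : Tensor4 (Fin q × Fin q)) :
    expect μ (fun V => lift4 (P * V.1 * Q)) *ᵥ x =
      ∑ b, weingartenCoeff x b • permTensor b := by
  rw [hμ.expect_lift4_mul_mul hP]
  set y := (expect (haarProb q) (fun V => lift4 V.1) * lift4 Q) *ᵥ x with hy
  have hinv : IsUnitaryInvariant y := fun R hR => by
    rw [hy, Matrix.mulVec_mulVec, ← mul_assoc, lift4_mul_expect_haarProb hR]
  have hpair : ∀ b, permTensor b ⬝ᵥ y = permTensor b ⬝ᵥ x := fun b => by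
    rw [hy, Matrix.dotProduct_mulVec, ← Matrix.vecMul_vecMul, permTensor_vecMul_expect_lift4,
      permTensor_vecMul_lift4 hQ]
  have hcoeff : ∀ b, weingartenCoeff y b = weingartenCoeff x b := fun b => by
    simp only [weingartenCoeff, hpair]
  simpa only [hcoeff] using hinv.eq_sum_weingartenCoeff

end Twirl

/-! ### Product tensors -/

section ProductTensor

variable {ι κ S : Type}

/-- The map on four-fold indices induced by a map on indices, such as the restriction of
configurations to a site. -/
def mapQuad (f : ι → κ) (e : Quad ι) : Quad κ := (f e.1, f e.2.1, f e.2.2.1, f e.2.2.2)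

theorem mapQuad_permQuad (f : ι → κ) (b : Bool) (p : ι × ι) :
    mapQuad f (permQuad b p) = permQuad b (p.map f f) := by
  cases b <;> rfl

/-- The tensor product of a family of site tensors. -/
def prodTensor [Fintype S] (τ : S → Tensor4 ι) : Tensor4 (S → ι) :=
  fun s => ∏ k, τ k (mapQuad (· k) s)

/-- The tensor product of two tensors. -/
def pairTensor (σ : Tensor4 ι) (τ : Tensor4 κ) : Tensor4 (ι × κ) :=
  fun e => σ (mapQuad Prod.fst e) * τ (mapQuad Prod.snd e)

theorem pairTensor_smul_smul (a b : ℂ) (σ : Tensor4 ι) (τ : Tensor4 κ) :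
    pairTensor (a • σ) (b • τ) = (a * b) • pairTensor σ τ := by
  funext e
  simp only [pairTensor, Pi.smul_apply, smul_eq_mul]
  ring

variable [DecidableEq ι] [DecidableEq κ]

theorem pairTensor_permTensor (b : Bool) :
    pairTensor (permTensor b : Tensor4 ι) (permTensor b : Tensor4 κ) = permTensor b := by
  funext e
  simp only [pairTensor, permTensor, ite_zero_mul_ite_zero, mul_one]
  refine if_congr ?_ rfl rfl
  cases b <;> simp [mapQuad, permQuad, Prod.ext_iff] <;> tauto

variable [Fintype ι] [Fintype κ]

theorem permTensor_dotProduct_pairTensor (b : Bool) (σ : Tensor4 ι) (τ : Tensor4 κ) :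
    permTensor b ⬝ᵥ pairTensor σ τ = (permTensor b ⬝ᵥ σ) * (permTensor b ⬝ᵥ τ) := by
  simp only [permTensor_dotProduct, pairTensor, mapQuad_permQuad]
  rw [Finset.sum_mul_sum, ← Fintype.sum_prod_type']
  exact Fintype.sum_equiv (Equiv.prodProdProdComm ι κ ι κ) _ _ fun _ => rfl

end ProductTensor

section State

theorem one_le_cast_card (ι : Type) [Fintype ι] [Nonempty ι] : (1 : ℝ) ≤ Fintype.card ι :=
  Nat.one_le_cast.mpr Fintype.card_pos

variable {ι : Type} [Fintype ι] [DecidableEq ι]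

/-- The purity of a tensor which is regarded as a state of two copies of a system. -/
def purity (τ : Tensor4 ι) : ℝ := (permTensor true ⬝ᵥ τ).re

/-- A tensor with the traces of a pair `ρ ⊗ ρ` of equal states: its trace is `1` and its trace
against the swap is a real number which lies between `1 / d` and `d`. -/
structure IsState (τ : Tensor4 ι) : Prop where
  id_eq : permTensor false ⬝ᵥ τ = 1
  swap_eq : permTensor true ⬝ᵥ τ = purity τ
  inv_card_le_purity : (Fintype.card ι : ℝ)⁻¹ ≤ purity τ
  purity_le_card : purity τ ≤ Fintype.card ι

theorem IsState.one_add_purity_nonneg {τ : Tensor4 ι} (hτ : IsState τ) : 0 ≤ 1 + purity τ :=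
  add_nonneg zero_le_one <|
    (inv_nonneg.mpr (Nat.cast_nonneg _)).trans hτ.inv_card_le_purity

/-- The identity and the swap, normalized to have trace `1`. -/
def permState (b : Bool) : Tensor4 ι :=
  ((permTensor false : Tensor4 ι) ⬝ᵥ permTensor b)⁻¹ • permTensor b

/-- Two copies of the pure state `|a⟩⟨a|`. -/
def basisState (a : ι) : Tensor4 ι := Pi.single (a, a, a, a) 1

theorem permTensor_dotProduct_basisState (b : Bool) (a : ι) :
    permTensor b ⬝ᵥ basisState a = 1 := by
  cases b <;> simp [basisState, permTensor, permQuad]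

theorem purity_basisState (a : ι) : purity (basisState a) = 1 := by
  simp [purity, permTensor_dotProduct_basisState]

theorem isState_basisState (a : ι) : IsState (basisState a) := by
  have : Nonempty ι := ⟨a⟩
  refine ⟨permTensor_dotProduct_basisState _ _, ?_, ?_, ?_⟩
  · rw [permTensor_dotProduct_basisState, purity_basisState, Complex.ofReal_one]
  · exact (inv_le_one_of_one_le₀ (one_le_cast_card ι)).trans_eq (purity_basisState a).symm
  · exact (purity_basisState a).trans_le (one_le_cast_card ι)

variable [Nonempty ι]

theorem permTensor_dotProduct_ne_zero (b b' : Bool) :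
    (permTensor b : Tensor4 ι) ⬝ᵥ permTensor b' ≠ 0 := by
  rw [permTensor_dotProduct_permTensor]
  split_ifs <;> simp

theorem permTensor_true_dotProduct_permState (b : Bool) :
    permTensor true ⬝ᵥ (permState b : Tensor4 ι) =
      bif b then (Fintype.card ι : ℂ) else (Fintype.card ι : ℂ)⁻¹ := by
  rw [permState, dotProduct_smul, permTensor_dotProduct_permTensor,
    permTensor_dotProduct_permTensor]
  cases b <;> simp <;> field_simp

theorem purity_permState (b : Bool) : purity (permState b : Tensor4 ι) =
    bif b then (Fintype.card ι : ℝ) else (Fintype.card ι : ℝ)⁻¹ := by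
  rw [purity, permTensor_true_dotProduct_permState]
  cases b <;> simp [← Complex.ofReal_natCast, ← Complex.ofReal_inv]

theorem isState_permState (b : Bool) : IsState (permState b : Tensor4 ι) := by
  have hcard := one_le_cast_card ι
  have hinv := inv_le_one_of_one_le₀ hcard
  refine ⟨?_, ?_, ?_, ?_⟩
  · rw [permState, dotProduct_smul, smul_eq_mul]
    exact inv_mul_cancel₀ (permTensor_dotProduct_ne_zero _ _)
  · rw [permTensor_true_dotProduct_permState, purity_permState]
    cases b <;> simp
  all_goals
    rw [purity_permState]
    cases b <;> simp only [cond_true, cond_false] <;> linarith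

end State

/-! ### The twirl of a pair of states -/

section PairTwirl

/-- The weight of the pair `permState b`, `permState b` in the twirl of a pair of states of a
`d`-dimensional system with purities `x` and `y`. -/
def twirlWeight (d x y : ℝ) (b : Bool) : ℝ :=
  (bif b then d ^ 2 * (x * y) - 1 else d ^ 2 * (d ^ 2 - x * y)) / (d ^ 4 - 1)

variable {d x y : ℝ}

theorem one_le_sq_mul_mul (hd : 0 < d) (hx : d⁻¹ ≤ x) (hy : d⁻¹ ≤ y) : 1 ≤ d ^ 2 * (x * y) := by
  have h := one_le_mul_of_one_le_of_one_le ((inv_le_iff_one_le_mul₀' hd).mp hx)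
    ((inv_le_iff_one_le_mul₀' hd).mp hy)
  linarith

theorem twirlWeight_nonneg (hd : 1 ≤ d) (hx : d⁻¹ ≤ x) (hx' : x ≤ d) (hy : d⁻¹ ≤ y) (hy' : y ≤ d)
    (b : Bool) : 0 ≤ twirlWeight d x y b := by
  have hd0 : 0 < d := zero_lt_one.trans_le hd
  have hxy : x * y ≤ d ^ 2 := by
    rw [sq]
    exact mul_le_mul hx' hy' ((inv_nonneg.mpr hd0.le).trans hy) hd0.le
  refine div_nonneg ?_ (sub_nonneg.mpr (one_le_pow₀ hd))
  cases b
  · exact mul_nonneg (sq_nonneg d) (sub_nonneg.mpr hxy)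
  · exact sub_nonneg.mpr (one_le_sq_mul_mul hd0 hx hy)

theorem two_mul_mul_one_add_mul_le (hd : 0 < d) (hx : d⁻¹ ≤ x) (hx' : x ≤ d) (hy : d⁻¹ ≤ y)
    (hy' : y ≤ d) : 2 * d * (1 + x * y) ≤ (d ^ 2 + 1) * (x + y) := by
  have hdx : 0 ≤ d * x - 1 := sub_nonneg.mpr ((inv_le_iff_one_le_mul₀' hd).mp hx)
  have hdy : 0 ≤ d * y - 1 := sub_nonneg.mpr ((inv_le_iff_one_le_mul₀' hd).mp hy)
  linarith [mul_nonneg hdx (sub_nonneg.mpr hy'), mul_nonneg hdy (sub_nonneg.mpr hx')]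

theorem sum_twirlWeight_mul_sq_le (hd : 1 < d) (hx : d⁻¹ ≤ x) (hx' : x ≤ d) (hy : d⁻¹ ≤ y)
    (hy' : y ≤ d) :
    ∑ b, twirlWeight d x y b * (1 + bif b then d else d⁻¹) ^ 2 ≤ (1 + x) * (1 + y) := by
  have hd0 : 0 < d := zero_lt_one.trans hd
  have hden : d ^ 4 - 1 ≠ 0 := (sub_pos.mpr (one_lt_pow₀ hd four_ne_zero)).ne'
  calc ∑ b, twirlWeight d x y b * (1 + bif b then d else d⁻¹) ^ 2
      = (d + 1) ^ 2 * (1 + x * y) / (d ^ 2 + 1) := by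
        simp only [Fintype.sum_bool, twirlWeight, cond_true, cond_false]
        field_simp
        ring
    _ ≤ (1 + x) * (1 + y) := by
        rw [div_le_iff₀ (by positivity)]
        linarith [two_mul_mul_one_add_mul_le hd0 hx hx' hy hy']

variable {q : ℕ} [Nontrivial (Fin q)] {μ : Measure (TwoQuditUnitary q)}
  {P Q : Matrix (Fin q × Fin q) (Fin q × Fin q) ℂ} {σ τ : Tensor4 (Fin q)}

theorem weingartenCoeff_smul_permTensor (hσ : IsState σ) (hτ : IsState τ) (b : Bool) :
    weingartenCoeff (pairTensor σ τ) b • (permTensor b : Tensor4 (Fin q × Fin q)) =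
      (twirlWeight q (purity σ) (purity τ) b : ℂ) • pairTensor (permState b) (permState b) := by
  have hq : (q : ℂ) ≠ 0 := by
    have : q ≠ 0 := fun h => by subst h; exact not_nontrivial (Fin 0) ‹_›
    exact_mod_cast this
  rw [permState, pairTensor_smul_smul, pairTensor_permTensor, smul_smul]
  congr 1
  simp only [weingartenCoeff, twirlWeight, permTensor_dotProduct_pairTensor,
    permTensor_dotProduct_permTensor, Fintype.card_prod, Fintype.card_fin]
  cases b <;> simp [hσ.id_eq, hσ.swap_eq, hτ.id_eq, hτ.swap_eq] <;> field_simp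

theorem IsTwoDesign.expect_lift4_mulVec_pairTensor (hμ : IsTwoDesign μ)
    (hP : P ∈ Matrix.unitaryGroup (Fin q × Fin q) ℂ)
    (hQ : Q ∈ Matrix.unitaryGroup (Fin q × Fin q) ℂ) (hσ : IsState σ) (hτ : IsState τ) :
    expect μ (fun V => lift4 (P * V.1 * Q)) *ᵥ pairTensor σ τ = ∑ b,
      (twirlWeight q (purity σ) (purity τ) b : ℂ) • pairTensor (permState b) (permState b) := by
  rw [hμ.expect_lift4_mulVec hP hQ]
  exact Finset.sum_congr rfl fun b _ => weingartenCoeff_smul_permTensor hσ hτ b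

end PairTwirl

/-! ### Two-site gates acting on product tensors -/

section SiteTwirl

variable {n q : ℕ} {i j : Fin n}

theorem updatePair_self_eq_or {α : Type*} (i j : Fin n) (f : Fin n → α) (a : α) (k : Fin n) :
    updatePair i j f (a, a) k = a ∨ (k ≠ i ∧ k ≠ j) ∧ updatePair i j f (a, a) k = f k := by
  simp only [updatePair, Function.update_apply]
  split_ifs <;> tauto

theorem prodTensor_updatePair_apply (hij : i ≠ j) (τ : Fin n → Tensor4 (Fin q))
    (p : Tensor4 (Fin q) × Tensor4 (Fin q)) (s : Quad (Fin n → Fin q)) :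
    prodTensor (updatePair i j τ p) s = pairTensor p.1 p.2 (mapQuad (fun r => (r i, r j)) s) *
      ∏ k ∈ {i, j}ᶜ, τ k (mapQuad (· k) s) :=
  prod_updatePair hij
    (fun k (σ : Tensor4 (Fin q)) => σ (mapQuad (fun r : Fin n → Fin q => r k) s)) τ p

theorem lift4_onSites_mulVec_prodTensor (hij : i ≠ j)
    (B : Matrix (Fin q × Fin q) (Fin q × Fin q) ℂ) (τ : Fin n → Tensor4 (Fin q))
    (s : Quad (Fin n → Fin q)) : (lift4 (onSites i j B) *ᵥ prodTensor τ) s =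
      (lift4 B *ᵥ pairTensor (τ i) (τ j)) (mapQuad (fun r => (r i, r j)) s) *
        ∏ k ∈ {i, j}ᶜ, τ k (mapQuad (· k) s) := by
  obtain ⟨s₁, s₂, s₃, s₄⟩ := s
  have hsum : ∀ (r : Fin n → Fin q) (g : (Fin n → Fin q) → ℂ),
      ∑ t, onSites i j B r t * g t = ∑ p, B (r i, r j) p * g (updatePair i j r p) :=
    fun r g => onSites_mulVec hij B g r
  have hstar : ∀ (r : Fin n → Fin q) (g : (Fin n → Fin q) → ℂ),
      ∑ t, star (onSites i j B r t) * g t =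
        ∑ p, star (B (r i, r j) p) * g (updatePair i j r p) := fun r g => by
    simpa [star_sum] using congrArg star (hsum r fun t => star (g t))
  have hval : ∀ p₁ p₂ p₃ p₄ : Fin q × Fin q,
      prodTensor τ (updatePair i j s₁ p₁, updatePair i j s₂ p₂, updatePair i j s₃ p₃,
        updatePair i j s₄ p₄) = pairTensor (τ i) (τ j) (p₁, p₂, p₃, p₄) *
          ∏ k ∈ {i, j}ᶜ, τ k (mapQuad (· k) (s₁, s₂, s₃, s₄)) := fun p₁ p₂ p₃ p₄ => by
    rw [prodTensor, prod_eq_mul_mul_prod_compl hij]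
    congr 1
    · simp only [mapQuad, updatePair_left hij, updatePair_right, pairTensor]
    · refine Finset.prod_congr rfl fun k hk => ?_
      obtain ⟨hi, hj⟩ : k ≠ i ∧ k ≠ j := by simpa using hk
      simp only [mapQuad, updatePair_of_ne hi hj]
  simp only [Matrix.mulVec, dotProduct, lift4_apply, Fintype.sum_prod_type (α₁ := Fin n → Fin q),
    mul_assoc, ← Finset.mul_sum, hstar, hsum, hval]
  simp only [Fintype.sum_prod_type (α₁ := Fin q × Fin q), Finset.mul_sum, Finset.sum_mul, mul_assoc,
    mapQuad]

/-- The product of the numbers `1 + purity (τ k)`. It does not increase under twirls, and starts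
from `2 ^ n`. -/
def symWeight (τ : Fin n → Tensor4 (Fin q)) : ℝ := ∏ k, (1 + purity (τ k))

theorem symWeight_updatePair (hij : i ≠ j) (τ : Fin n → Tensor4 (Fin q))
    (p : Tensor4 (Fin q) × Tensor4 (Fin q)) : symWeight (updatePair i j τ p) =
      (1 + purity p.1) * (1 + purity p.2) * ∏ k ∈ {i, j}ᶜ, (1 + purity (τ k)) :=
  prod_updatePair hij (fun _ σ => 1 + purity σ) τ p

/-- `E` maps product states to nonnegative combinations of product tensors in which both sites `i`
and `j` are replaced by a normalized identity or by a normalized swap, without increasing the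
weight. -/
def IsPairTwirl (E : Matrix (Quad (Fin n → Fin q)) (Quad (Fin n → Fin q)) ℂ) (i j : Fin n) :
    Prop :=
  ∀ τ : Fin n → Tensor4 (Fin q), (∀ k, IsState (τ k)) → ∃ a : Bool → ℝ, (∀ b, 0 ≤ a b) ∧
    E *ᵥ prodTensor τ =
      ∑ b, (a b : ℂ) • prodTensor (updatePair i j τ (permState b, permState b)) ∧
    ∑ b, a b * symWeight (updatePair i j τ (permState b, permState b)) ≤ symWeight τ

variable {μ : Measure (TwoQuditUnitary q)} {P Q : Matrix (Fin q × Fin q) (Fin q × Fin q) ℂ}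

theorem expect_lift4_onSites_mulVec_prodTensor [IsFiniteMeasure μ] (hij : i ≠ j)
    (P Q : Matrix (Fin q × Fin q) (Fin q × Fin q) ℂ) (τ : Fin n → Tensor4 (Fin q))
    (s : Quad (Fin n → Fin q)) :
    (expect μ (fun V => lift4 (onSites i j (P * V.1 * Q))) *ᵥ prodTensor τ) s =
      (expect μ (fun V => lift4 (P * V.1 * Q)) *ᵥ pairTensor (τ i) (τ j))
        (mapQuad (fun r => (r i, r j)) s) * ∏ k ∈ {i, j}ᶜ, τ k (mapQuad (· k) s) := by
  have hcont : Continuous fun V : TwoQuditUnitary q => P * V.1 * Q :=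
    (continuous_const.mul continuous_subtype_val).mul continuous_const
  have hint : ∀ e f, Integrable (fun V : TwoQuditUnitary q => lift4 (P * V.1 * Q) e f) μ :=
    integrable_entry_of_continuous (continuous_lift4.comp hcont)
  have hint' : ∀ e f, Integrable
      (fun V : TwoQuditUnitary q => lift4 (onSites i j (P * V.1 * Q)) e f) μ :=
    integrable_entry_of_continuous (continuous_lift4.comp ((continuous_onSites i j).comp hcont))
  rw [expect_mulVec hint, expect_mulVec hint', ← integral_mul_const]
  exact integral_congr_ae <| .of_forall fun V => lift4_onSites_mulVec_prodTensor hij _ τ s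

theorem IsTwoDesign.isPairTwirl [Nontrivial (Fin q)] (hμ : IsTwoDesign μ) (hij : i ≠ j)
    (hP : P ∈ Matrix.unitaryGroup (Fin q × Fin q) ℂ)
    (hQ : Q ∈ Matrix.unitaryGroup (Fin q × Fin q) ℂ) :
    IsPairTwirl (expect μ fun V => lift4 (onSites i j (P * V.1 * Q))) i j := by
  intro τ hτ
  have := hμ.isProbabilityMeasure
  have hq : (1 : ℝ) < q := by
    simpa using Nat.one_lt_cast (α := ℝ).mpr (Fintype.one_lt_card (α := Fin q))
  have hx := fun k => (hτ k).inv_card_le_purity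
  have hx' := fun k => (hτ k).purity_le_card
  simp only [Fintype.card_fin] at hx hx'
  refine ⟨twirlWeight q (purity (τ i)) (purity (τ j)),
    twirlWeight_nonneg hq.le (hx i) (hx' i) (hx j) (hx' j), ?_, ?_⟩
  · funext s
    rw [expect_lift4_onSites_mulVec_prodTensor hij,
      hμ.expect_lift4_mulVec_pairTensor hP hQ (hτ i) (hτ j)]
    simp only [Finset.sum_apply, Pi.smul_apply, smul_eq_mul, Finset.sum_mul, mul_assoc,
      prodTensor_updatePair_apply hij]
  · simp only [symWeight_updatePair hij, purity_permState, Fintype.card_fin, ← sq, ← mul_assoc]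
    rw [← Finset.sum_mul, symWeight, prod_eq_mul_mul_prod_compl hij]
    exact mul_le_mul_of_nonneg_right (sum_twirlWeight_mul_sq_le hq (hx i) (hx' i) (hx j) (hx' j))
      (Finset.prod_nonneg fun k _ => (hτ k).one_add_purity_nonneg)

variable {τ : Fin n → Tensor4 (Fin q)} {w : Tensor4 (Fin n → Fin q)} {K : ℝ}

theorem IsPairTwirl.re_dotProduct_mulVec_le
    {E : Matrix (Quad (Fin n → Fin q)) (Quad (Fin n → Fin q)) ℂ} (hE : IsPairTwirl E i j)
    (hτ : ∀ k, IsState (τ k)) (hK : 0 ≤ K)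
    (hw : ∀ b, (w ⬝ᵥ prodTensor (updatePair i j τ (permState b, permState b))).re ≤
      K * symWeight (updatePair i j τ (permState b, permState b))) :
    (w ⬝ᵥ (E *ᵥ prodTensor τ)).re ≤ K * symWeight τ := by
  obtain ⟨a, ha, hEτ, hweight⟩ := hE τ hτ
  rw [hEτ, dotProduct_sum, Complex.re_sum]
  simp only [dotProduct_smul, smul_eq_mul, Complex.re_ofReal_mul]
  calc ∑ b, a b * (w ⬝ᵥ prodTensor (updatePair i j τ (permState b, permState b))).re
      ≤ ∑ b, a b * (K * symWeight (updatePair i j τ (permState b, permState b))) :=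
        Finset.sum_le_sum fun b _ => mul_le_mul_of_nonneg_left (hw b) (ha b)
    _ = K * ∑ b, a b * symWeight (updatePair i j τ (permState b, permState b)) := by
        simp only [Finset.mul_sum, mul_left_comm]
    _ ≤ K * symWeight τ := mul_le_mul_of_nonneg_left hweight hK

theorem re_dotProduct_timeProd_mulVec_le [Nonempty (Fin q)] {r : ℕ} {i j : Fin r → Fin n}
    {E : Fin r → Matrix (Quad (Fin n → Fin q)) (Quad (Fin n → Fin q)) ℂ} (hK : 0 ≤ K)
    (hw : ∀ σ : Fin n → Bool,
      (w ⬝ᵥ prodTensor fun k => permState (σ k)).re ≤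
        K * symWeight fun k => (permState (σ k) : Tensor4 (Fin q)))
    (hE : ∀ t, IsPairTwirl (E t) (i t) (j t)) (hτ : ∀ k, IsState (τ k))
    (hcov : ∀ k, (∃ t, k = i t ∨ k = j t) ∨ τ k ∈ Set.range permState) :
    (w ⬝ᵥ (timeProd E *ᵥ prodTensor τ)).re ≤ K * symWeight τ := by
  induction r generalizing τ with
  | zero =>
    choose σ hσ using fun k => (hcov k).resolve_left fun ⟨t, _⟩ => t.elim0
    obtain rfl : (fun k => permState (σ k)) = τ := funext hσ
    simpa only [timeProd_zero, Matrix.one_mulVec] using hw σ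
  | succ r ih =>
    rw [timeProd_succ, ← Matrix.mulVec_mulVec, Matrix.dotProduct_mulVec]
    refine (hE 0).re_dotProduct_mulVec_le hτ hK fun b => ?_
    rw [← Matrix.dotProduct_mulVec]
    have hupdate := updatePair_self_eq_or (i 0) (j 0) τ (permState b)
    refine ih (fun t => hE t.succ) (fun k => ?_) fun k => ?_
    · obtain hk | ⟨-, hk⟩ := hupdate k
      · exact hk.symm ▸ isState_permState b
      · exact hk.symm ▸ hτ k
    · obtain hk | ⟨hne, hk⟩ := hupdate k
      · exact .inr ⟨b, hk.symm⟩
      · rw [hk]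
        refine (hcov k).imp_left fun ⟨t, ht⟩ => ?_
        cases t using Fin.cases with
        | zero => exact absurd ht (not_or.mpr hne)
        | succ t => exact ⟨t, ht⟩

end SiteTwirl

/-! ### The coefficients of an observable -/

section Basis

variable {n q : ℕ} {M : Fin (q ^ 2) → Matrix (Fin q) (Fin q) ℂ}

theorem trace_conjTranspose_tensorOp_mul (M : Fin (q ^ 2) → Matrix (Fin q) (Fin q) ℂ)
    (x y : Fin n → Fin (q ^ 2)) : ((tensorOp M x)ᴴ * tensorOp M y).trace =
      ∏ k, ((M (x k))ᴴ * M (y k)).trace := by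
  simp only [Matrix.trace, Matrix.diag_apply, Matrix.mul_apply, Matrix.conjTranspose_apply,
    tensorOp, Matrix.of_apply, star_prod, ← Finset.prod_mul_distrib, Finset.prod_univ_sum,
    Fintype.piFinset_univ]

theorem IsOperatorBasis.coeff_tensorOp [NeZero q] (hM : IsOperatorBasis M)
    (x y : Fin n → Fin (q ^ 2)) : coeff M (tensorOp M y) x = if x = y then 1 else 0 := by
  simp only [coeff, trace_conjTranspose_tensorOp_mul, hM.trace_eq, Finset.prod_ite_zero,
    Finset.prod_const, Finset.card_univ, Fintype.card_fin, Finset.mem_univ, forall_const,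
    funext_iff (f := x), mul_ite, mul_zero]
  rw [inv_mul_cancel₀ (pow_ne_zero n (NeZero.ne (q : ℂ)))]

theorem coeff_sum_smul (M : Fin (q ^ 2) → Matrix (Fin q) (Fin q) ℂ) {X : Type*} [Fintype X]
    (c : X → ℂ) (O : X → Op n q) (x : Fin n → Fin (q ^ 2)) :
    coeff M (∑ y, c y • O y) x = ∑ y, c y * coeff M (O y) x := by
  simp only [coeff, Matrix.mul_smul, Matrix.trace_sum, Matrix.trace_smul, smul_eq_mul,
    Finset.mul_sum, mul_left_comm]

theorem IsOperatorBasis.coeff_sum_smul_tensorOp [NeZero q] (hM : IsOperatorBasis M)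
    (c : (Fin n → Fin (q ^ 2)) → ℂ) : coeff M (∑ x, c x • tensorOp M x) = c := by
  funext x
  simp [coeff_sum_smul, hM.coeff_tensorOp]

theorem IsOperatorBasis.sum_coeff_smul_tensorOp [NeZero q] (hM : IsOperatorBasis M)
    (H : Op n q) : ∑ x, coeff M H x • tensorOp M x = H := by
  have hinj : Function.Injective (Fintype.linearCombination ℂ (tensorOp (n := n) M)) :=
    Function.LeftInverse.injective (g := coeff M) hM.coeff_sum_smul_tensorOp
  have hdim : Module.finrank ℂ ((Fin n → Fin (q ^ 2)) → ℂ) = Module.finrank ℂ (Op n q) := by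
    simp [Module.finrank_matrix, ← mul_pow, sq]
  obtain ⟨c, rfl⟩ := (LinearMap.injective_iff_surjective_of_finrank_eq_finrank hdim).mp hinj H
  rw [Fintype.linearCombination_apply, hM.coeff_sum_smul_tensorOp]

end Basis

/-! ### Two copies of an observable -/

section SecondMoment

variable {ι S : Type}

/-- The functional `ρ ⊗ ρ' ↦ tr (O ρ) · tr (O'† ρ')`, as a tensor. -/
def opTensor (O O' : Matrix ι ι ℂ) : Tensor4 ι :=
  fun a => O a.2.2.1 a.1 * star (O' a.2.1 a.2.2.2)

theorem opTensor_sum_smul {X : Type*} [Fintype X] (c : X → ℂ) (O : X → Matrix ι ι ℂ) :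
    opTensor (∑ x, c x • O x) (∑ x, c x • O x) =
      ∑ x, ∑ y, (c x * star (c y)) • opTensor (O x) (O y) := by
  funext a
  simp only [opTensor, Matrix.sum_apply, Matrix.smul_apply, Finset.sum_apply, Pi.smul_apply,
    smul_eq_mul, star_sum, star_mul', Finset.sum_mul_sum, mul_mul_mul_comm]

theorem prodTensor_basisState [Fintype S] [DecidableEq ι] (a : S → ι) :
    prodTensor (fun k => basisState (a k)) = basisState a := by
  classical
  funext s
  simp only [prodTensor, basisState, Pi.single_apply, Finset.prod_ite_zero, Finset.prod_const_one]
  exact if_congr (by simp [mapQuad, Prod.ext_iff, funext_iff, forall_and]) rfl rfl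

variable [Fintype ι]

theorem norm_sq_eq_opTensor_dotProduct [DecidableEq ι] (O U : Matrix ι ι ℂ) (z : ι) :
    ((‖(Uᴴ * O * U) z z‖ ^ 2 : ℝ) : ℂ) = opTensor O O ⬝ᵥ (lift4 U *ᵥ basisState z) := by
  have hentry : (Uᴴ * O * U) z z = ∑ a, ∑ c, star (U c z) * O c a * U a z := by
    simp [Matrix.mul_apply, Finset.sum_mul]
  have hstar : star ((Uᴴ * O * U) z z) = ∑ b, ∑ d, U b z * star (O b d) * star (U d z) := by
    rw [hentry, Finset.sum_comm]
    simp [star_sum, mul_comm]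
  rw [Complex.ofReal_pow, ← Complex.mul_conj', starRingEnd_apply, hstar, hentry, basisState,
    Matrix.mulVec_single_one, Finset.sum_mul_sum]
  simp only [dotProduct, Fintype.sum_prod_type, Matrix.col_apply, lift4_apply, opTensor]
  refine Finset.sum_congr rfl fun a _ => Finset.sum_congr rfl fun b _ => ?_
  rw [Finset.sum_mul_sum]
  refine Finset.sum_congr rfl fun c _ => Finset.sum_congr rfl fun d _ => ?_
  ring

theorem permTensor_dotProduct_opTensor [DecidableEq ι] (O O' : Matrix ι ι ℂ) (b : Bool) :
    permTensor b ⬝ᵥ opTensor O O' = bif b then (O'ᴴ * O).trace else O.trace * star O'.trace := by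
  rw [permTensor_dotProduct, Fintype.sum_prod_type]
  cases b
  · simp [permQuad, opTensor, Matrix.trace, Finset.sum_mul_sum]
  · simp [permQuad, opTensor, Matrix.trace, Matrix.mul_apply, mul_comm]

/-- Four configurations of a family of sites, as a family of four-fold indices. -/
def quadPiEquiv : Quad (S → ι) ≃ (S → Quad ι) where
  toFun s k := mapQuad (· k) s
  invFun e := (fun k => (e k).1, fun k => (e k).2.1, fun k => (e k).2.2.1, fun k => (e k).2.2.2)

theorem prodTensor_dotProduct_prodTensor [Fintype S] [DecidableEq S] (σ τ : S → Tensor4 ι) :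
    prodTensor σ ⬝ᵥ prodTensor τ = ∏ k, σ k ⬝ᵥ τ k := by
  simp only [dotProduct, Finset.prod_univ_sum, Fintype.piFinset_univ, prodTensor,
    ← Finset.prod_mul_distrib]
  exact Fintype.sum_equiv quadPiEquiv _ _ fun _ => rfl

variable {n q : ℕ} {M : Fin (q ^ 2) → Matrix (Fin q) (Fin q) ℂ}

theorem opTensor_tensorOp (x y : Fin n → Fin (q ^ 2)) :
    opTensor (tensorOp M x) (tensorOp M y) = prodTensor fun k => opTensor (M (x k)) (M (y k)) := by
  funext s
  simp only [opTensor, tensorOp, Matrix.of_apply, star_prod, ← Finset.prod_mul_distrib]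
  rfl

variable [NeZero q]

theorem IsOperatorBasis.trace_eq_ite (hM : IsOperatorBasis M) (x : Fin (q ^ 2)) :
    (M x).trace = if x = 0 then (q : ℂ) else 0 := by
  simpa [hM.zero_eq, eq_comm] using hM.trace_eq 0 x

theorem IsOperatorBasis.opTensor_dotProduct_permState (hM : IsOperatorBasis M)
    (x y : Fin (q ^ 2)) (b : Bool) :
    opTensor (M x) (M y) ⬝ᵥ permState b = if x = y ∧ (b ∨ x = 0) then 1 else 0 := by
  have hq : (q : ℂ) ≠ 0 := NeZero.ne _
  rw [dotProduct_comm, permState, smul_dotProduct, permTensor_dotProduct_opTensor,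
    permTensor_dotProduct_permTensor, hM.trace_eq, hM.trace_eq_ite, hM.trace_eq_ite]
  cases b
  · by_cases hx : x = 0 <;> by_cases hy : y = 0 <;> simp [hx, hy, eq_comm]
    field_simp
  · by_cases hx : x = y <;> simp [hx, eq_comm, hq]

theorem IsOperatorBasis.opTensor_tensorOp_dotProduct (hM : IsOperatorBasis M)
    (x y : Fin n → Fin (q ^ 2)) (σ : Fin n → Bool) :
    opTensor (tensorOp M x) (tensorOp M y) ⬝ᵥ prodTensor (fun k => permState (σ k)) =
      if x = y ∧ ∀ k, σ k ∨ x k = 0 then 1 else 0 := by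
  simp only [opTensor_tensorOp, prodTensor_dotProduct_prodTensor, hM.opTensor_dotProduct_permState,
    Finset.prod_ite_zero, Finset.prod_const_one, Finset.mem_univ, true_imp_iff, forall_and,
    funext_iff]

theorem IsOperatorBasis.opTensor_dotProduct_prodTensor (hM : IsOperatorBasis M) (O : Op n q)
    (σ : Fin n → Bool) :
    opTensor O O ⬝ᵥ prodTensor (fun k => permState (σ k)) =
      ((∑ x, if ∀ k, σ k ∨ x k = 0 then ‖coeff M O x‖ ^ 2 else 0 : ℝ) : ℂ) := by
  conv_lhs => rw [← hM.sum_coeff_smul_tensorOp O, opTensor_sum_smul]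
  simp only [sum_dotProduct, smul_dotProduct, hM.opTensor_tensorOp_dotProduct, smul_eq_mul,
    ite_and, mul_ite, mul_one, mul_zero, Finset.sum_ite_eq, Finset.mem_univ, if_true,
    Complex.ofReal_sum]
  refine Finset.sum_congr rfl fun x _ => ?_
  split_ifs
  · rw [Complex.ofReal_pow, ← Complex.mul_conj', starRingEnd_apply]
  · simp

theorem symWeight_permState (σ : Fin n → Bool) :
    symWeight (fun k => (permState (σ k) : Tensor4 (Fin q))) =
      ((q + 1 : ℝ) / q) ^ n * (q : ℝ) ^ (Finset.univ.filter fun k => σ k).card := by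
  have hq : (q : ℝ) ≠ 0 := NeZero.ne _
  have hfactor : ∀ k, 1 + purity (permState (σ k) : Tensor4 (Fin q)) =
      (q + 1 : ℝ) / q * if σ k then (q : ℝ) else 1 := fun k => by
    rw [purity_permState, Fintype.card_fin]
    cases σ k <;> simp <;> field_simp
    ring
  simp only [symWeight, hfactor, Finset.prod_mul_distrib, Finset.prod_ite, Finset.prod_const,
    one_pow, mul_one, Finset.card_univ, Fintype.card_fin]

theorem IsOperatorBasis.re_opTensor_dotProduct_le (hM : IsOperatorBasis M) (O : Op n q)
    (σ : Fin n → Bool) :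
    (opTensor O O ⬝ᵥ prodTensor (fun k => permState (σ k))).re ≤
      ((q / (q + 1) : ℝ) ^ n * ∑ x, ‖coeff M O x‖ ^ 2 * (q : ℝ)⁻¹ ^ weight x) *
        symWeight fun k => (permState (σ k) : Tensor4 (Fin q)) := by
  have hq : (0 : ℝ) < q := Nat.cast_pos.mpr (NeZero.pos q)
  rw [hM.opTensor_dotProduct_prodTensor, Complex.ofReal_re, symWeight_permState, Finset.mul_sum,
    Finset.sum_mul]
  refine Finset.sum_le_sum fun x _ => ?_
  split_ifs with hx
  · have hweight : weight x ≤ (Finset.univ.filter fun k => σ k).card :=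
      Finset.card_le_card <| Finset.monotone_filter_right _ fun k _ hk => (hx k).resolve_right hk
    have hpow : 1 ≤ (q : ℝ)⁻¹ ^ weight x * (q : ℝ) ^ (Finset.univ.filter fun k => σ k).card := by
      rw [inv_pow, inv_mul_eq_div, one_le_div (pow_pos hq _)]
      exact pow_le_pow_right₀ (Nat.one_le_cast.mpr NeZero.one_le) hweight
    have hcancel : (q / (q + 1) : ℝ) ^ n * ((q + 1) / q) ^ n = 1 := by
      rw [← mul_pow, div_mul_div_cancel₀ (by positivity), div_self hq.ne', one_pow]
    calc ‖coeff M O x‖ ^ 2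
        ≤ ‖coeff M O x‖ ^ 2 *
            ((q : ℝ)⁻¹ ^ weight x * (q : ℝ) ^ (Finset.univ.filter fun k => σ k).card) :=
          le_mul_of_one_le_right (sq_nonneg _) hpow
      _ = _ := by
        linear_combination -(‖coeff M O x‖ ^ 2 * ((q : ℝ)⁻¹ ^ weight x *
          (q : ℝ) ^ (Finset.univ.filter fun k => σ k).card)) * hcancel
  · positivity

end SecondMoment

/-! ### The unitary circuit -/

section ParameterizedGate

theorem exp_mem_unitaryGroup {ι : Type} [Fintype ι] [DecidableEq ι] {A : Matrix ι ι ℂ}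
    (hA : A.IsHermitian) (θ : ℝ) :
    NormedSpace.exp ((-(Complex.I * (θ : ℂ))) • A) ∈ Matrix.unitaryGroup ι ℂ := by
  have hskew : ((-(Complex.I * (θ : ℂ))) • A)ᴴ = -((-(Complex.I * (θ : ℂ))) • A) := by
    rw [Matrix.conjTranspose_smul, hA.eq, ← neg_smul]
    simp
  rw [Matrix.mem_unitaryGroup_iff, Matrix.star_eq_conjTranspose, ← Matrix.exp_conjTranspose,
    hskew]
  generalize (-(Complex.I * (θ : ℂ))) • A = X
  rw [← Matrix.exp_add_of_commute X (-X) (Commute.refl X).neg_right, add_neg_cancel,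
    NormedSpace.exp_zero]

open scoped Matrix.Norms.L2Operator in
theorem continuous_exp_smul {ι : Type} [Fintype ι] [DecidableEq ι] (A : Matrix ι ι ℂ) :
    Continuous fun θ : ℝ => NormedSpace.exp ((-(Complex.I * (θ : ℂ))) • A) := by
  let : NormedAlgebra ℚ (Matrix ι ι ℂ) := NormedAlgebra.restrictScalars ℚ ℂ _
  exact NormedSpace.exp_continuous.comp (by fun_prop)

namespace ParamGate

variable {q : ℕ} (G : ParamGate q)

theorem eval_mem_unitaryGroup (θ : ℝ) : G.eval θ ∈ Matrix.unitaryGroup (Fin q × Fin q) ℂ :=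
  mul_mem (mul_mem G.Wl.2 (exp_mem_unitaryGroup G.isHermitian θ)) G.Wr.2

theorem continuous_eval : Continuous G.eval :=
  (continuous_const.mul (continuous_exp_smul G.A)).mul continuous_const

end ParamGate

end ParameterizedGate

namespace Ansatz

variable {n q : ℕ} (C : Ansatz n q)

/-- The product of the parameterized gates preceding the `t`-th entangling gate. -/
def preProd (θ : C.Param → ℝ) (t : Fin C.m) : Matrix (Fin q × Fin q) (Fin q × Fin q) ℂ :=
  timeProd fun a => (C.pre t a).eval (θ ⟨t, Sum.inl a⟩)

/-- The product of the parameterized gates succeeding the `t`-th entangling gate. -/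
def postProd (θ : C.Param → ℝ) (t : Fin C.m) : Matrix (Fin q × Fin q) (Fin q × Fin q) ℂ :=
  timeProd fun b => (C.post t b).eval (θ ⟨t, Sum.inr b⟩)

theorem block_eq (V : C.Realization) (θ : C.Param → ℝ) (t : Fin C.m) :
    C.block V θ t = C.postProd θ t * (V t).1 * C.preProd θ t := rfl

theorem preProd_mem_unitaryGroup (θ : C.Param → ℝ) (t : Fin C.m) :
    C.preProd θ t ∈ Matrix.unitaryGroup (Fin q × Fin q) ℂ :=
  timeProd_mem_unitaryGroup fun _ => ParamGate.eval_mem_unitaryGroup _ _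

theorem postProd_mem_unitaryGroup (θ : C.Param → ℝ) (t : Fin C.m) :
    C.postProd θ t ∈ Matrix.unitaryGroup (Fin q × Fin q) ℂ :=
  timeProd_mem_unitaryGroup fun _ => ParamGate.eval_mem_unitaryGroup _ _

theorem block_mem_unitaryGroup (V : C.Realization) (θ : C.Param → ℝ) (t : Fin C.m) :
    C.block V θ t ∈ Matrix.unitaryGroup (Fin q × Fin q) ℂ :=
  mul_mem (mul_mem (C.postProd_mem_unitaryGroup θ t) (V t).2) (C.preProd_mem_unitaryGroup θ t)

theorem circuit_mem_unitaryGroup (V : C.Realization) (θ : C.Param → ℝ) :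
    C.circuit V θ ∈ Matrix.unitaryGroup (Fin n → Fin q) ℂ :=
  timeProd_mem_unitaryGroup fun t =>
    onSites_mem_unitaryGroup (C.site_ne t) (C.block_mem_unitaryGroup V θ t)

theorem continuous_preProd (t : Fin C.m) : Continuous fun θ => C.preProd θ t :=
  continuous_timeProd fun _ => (ParamGate.continuous_eval _).comp (continuous_apply _)

theorem continuous_postProd (t : Fin C.m) : Continuous fun θ => C.postProd θ t :=
  continuous_timeProd fun _ => (ParamGate.continuous_eval _).comp (continuous_apply _)

theorem continuous_circuit :
    Continuous fun p : C.Realization × (C.Param → ℝ) => C.circuit p.1 p.2 :=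
  continuous_timeProd fun t => (continuous_onSites _ _).comp <|
    (((C.continuous_postProd t).comp continuous_snd).mul
      (continuous_subtype_val.comp ((continuous_apply t).comp continuous_fst))).mul
      ((C.continuous_preProd t).comp continuous_snd)

theorem continuous_expval [NeZero q] (O : Op n q) :
    Continuous fun p : C.Realization × (C.Param → ℝ) => C.expval O p.1 p.2 :=
  ((C.continuous_circuit.matrix_conjTranspose.mul continuous_const).mul
    C.continuous_circuit).matrix_elem _ _

end Ansatz

/-! ### The operator norm -/

section OperatorNorm

open scoped Matrix.Norms.L2Operator

variable {ι : Type} [Fintype ι] [DecidableEq ι]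

theorem norm_conjTranspose_mul_mul {U : Matrix ι ι ℂ} (hU : U ∈ Matrix.unitaryGroup ι ℂ)
    (B : Matrix ι ι ℂ) : ‖Uᴴ * B * U‖ = ‖B‖ := by
  rw [CStarRing.norm_mul_mem_unitary _ hU]
  exact CStarRing.norm_mem_unitary_mul _ (Unitary.star_mem hU)

theorem norm_entry_le_norm (B : Matrix ι ι ℂ) (a b : ι) : ‖B a b‖ ≤ ‖B‖ :=
  calc ‖B a b‖ = ‖WithLp.toLp 2 (B *ᵥ EuclideanSpace.single b (1 : ℂ)) a‖ := by simp
    _ ≤ ‖WithLp.toLp 2 (B *ᵥ EuclideanSpace.single b (1 : ℂ))‖ := PiLp.norm_apply_le _ a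
    _ ≤ ‖B‖ * ‖EuclideanSpace.single b (1 : ℂ)‖ := Matrix.l2_opNorm_mulVec B _
    _ = ‖B‖ := by rw [PiLp.norm_single, norm_one, mul_one]

theorem Ansatz.norm_expval_le {n q : ℕ} [NeZero q] (C : Ansatz n q) (O : Op n q)
    (V : C.Realization) (θ : C.Param → ℝ) : ‖C.expval O V θ‖ ≤ opNorm O :=
  (norm_entry_le_norm _ _ _).trans_eq
    (norm_conjTranspose_mul_mul (C.circuit_mem_unitaryGroup V θ) O)

end OperatorNorm

/-! ### Averages over the gates and the parameters -/

instance (q : ℕ) : SecondCountableTopology (TwoQuditUnitary q) :=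
  have : SecondCountableTopology (Matrix (Fin q × Fin q) (Fin q × Fin q) ℂ) :=
    inferInstanceAs (SecondCountableTopology (Fin q × Fin q → Fin q × Fin q → ℂ))
  Topology.IsEmbedding.subtypeVal.secondCountableTopology

theorem isProbabilityMeasure_cond_Icc {a b : ℝ} (hab : a < b) :
    IsProbabilityMeasure (ProbabilityTheory.cond volume (Set.Icc a b)) :=
  ProbabilityTheory.cond_isProbabilityMeasure_of_finite (by simp [hab]) (by simp)

theorem integral_abs_le_sqrt_integral_sq {Ω : Type*} [MeasurableSpace Ω] {μ : Measure Ω}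
    [IsProbabilityMeasure μ] {f : Ω → ℝ} (hf : MemLp f 2 μ) :
    ∫ ω, |f ω| ∂μ ≤ √(∫ ω, f ω ^ 2 ∂μ) := by
  have hvar := ProbabilityTheory.variance_nonneg |f| μ
  rw [ProbabilityTheory.variance_eq_sub hf.abs, sub_nonneg] at hvar
  exact Real.le_sqrt_of_sq_le (by simpa using hvar)

namespace Ansatz

variable {n q : ℕ} (C : Ansatz n q)

instance (t : Fin C.m) : IsProbabilityMeasure (C.law t) := (C.isTwoDesign t).isProbabilityMeasure

instance : IsProbabilityMeasure C.gateLaw := by unfold gateLaw; infer_instance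

instance : IsProbabilityMeasure
    (ProbabilityTheory.cond volume (Set.Icc 0 (2 * Real.pi)) : Measure ℝ) :=
  isProbabilityMeasure_cond_Icc Real.two_pi_pos

instance : IsProbabilityMeasure C.paramLaw := by unfold paramLaw; infer_instance

variable [NeZero q]

theorem integrable_comp_expval {X : Type*} [TopologicalSpace X] [MeasurableSpace X]
    [OpensMeasurableSpace X] {ν : Measure X} [IsFiniteMeasure ν]
    {p : X → C.Realization × (C.Param → ℝ)} (hp : Continuous p) {φ : ℂ → ℝ} (hφ : Continuous φ)
    (O : Op n q) : Integrable (fun x => φ (C.expval O (p x).1 (p x).2)) ν := by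
  obtain ⟨B, hB⟩ := (isCompact_closedBall (0 : ℂ) (opNorm O)).exists_bound_of_continuousOn
    hφ.continuousOn
  refine .of_bound (hφ.comp ((C.continuous_expval O).comp hp)).aestronglyMeasurable B ?_
  exact .of_forall fun x => hB _ (mem_closedBall_zero_iff.2 (C.norm_expval_le O _ _))

theorem average_comp_expval {φ : ℂ → ℝ} (hφ : Continuous φ) (O : Op n q) :
    C.average (fun V θ => φ (C.expval O V θ)) =
      ∫ p, φ (C.expval O p.1 p.2) ∂(C.gateLaw.prod C.paramLaw) :=
  (integral_prod _ (C.integrable_comp_expval continuous_id hφ O)).symm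

theorem average_comp_expval_mono {φ ψ : ℂ → ℝ} (hφ : Continuous φ) (hψ : Continuous ψ)
    (hφψ : ∀ z, φ z ≤ ψ z) (O : Op n q) :
    C.average (fun V θ => φ (C.expval O V θ)) ≤ C.average fun V θ => ψ (C.expval O V θ) := by
  rw [C.average_comp_expval hφ, C.average_comp_expval hψ]
  exact integral_mono (C.integrable_comp_expval continuous_id hφ O)
    (C.integrable_comp_expval continuous_id hψ O) fun _ => hφψ _

theorem average_abs_objective_le (H : Op n q) :
    C.average (fun V θ => |C.objective H V θ|) ≤
      √(C.average fun V θ => C.objective H V θ ^ 2) := by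
  have hre := C.integrable_comp_expval (ν := C.gateLaw.prod C.paramLaw) continuous_id
    Complex.continuous_re H
  have hsq := C.integrable_comp_expval (ν := C.gateLaw.prod C.paramLaw) continuous_id
    (φ := fun z => z.re ^ 2) (by fun_prop) H
  simp only [objective]
  rw [C.average_comp_expval (φ := fun z => |z.re|) (by fun_prop),
    C.average_comp_expval (φ := fun z => z.re ^ 2) (by fun_prop)]
  exact integral_abs_le_sqrt_integral_sq ((memLp_two_iff_integrable_sq hre.1).2 hsq)

end Ansatz

/-! ### The second moment of an expectation value -/

namespace Ansatz

variable {n q : ℕ} (C : Ansatz n q)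

theorem continuous_circuit_left (θ : C.Param → ℝ) : Continuous fun V => C.circuit V θ :=
  C.continuous_circuit.comp (f := fun V => (V, θ)) (by fun_prop)

theorem expect_lift4_circuit (θ : C.Param → ℝ) :
    expect C.gateLaw (fun V => lift4 (C.circuit V θ)) =
      timeProd fun t => expect (C.law t) fun V =>
        lift4 (onSites (C.site₁ t) (C.site₂ t) (C.postProd θ t * V.1 * C.preProd θ t)) := by
  simp only [circuit, map_timeProd]
  exact expect_timeProd fun t => integrable_entry_of_continuous <|
    continuous_lift4.comp <| (continuous_onSites _ _).comp <|
      (continuous_const.mul continuous_subtype_val).mul continuous_const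

variable [NeZero q]

theorem integral_norm_expval_sq (O : Op n q) (θ : C.Param → ℝ) :
    ((∫ V, ‖C.expval O V θ‖ ^ 2 ∂C.gateLaw : ℝ) : ℂ) = opTensor O O ⬝ᵥ
      (expect C.gateLaw (fun V => lift4 (C.circuit V θ)) *ᵥ basisState fun _ => 0) := by
  have hint : ∀ a b, Integrable (fun V => lift4 (C.circuit V θ) a b) C.gateLaw :=
    integrable_entry_of_continuous (continuous_lift4.comp (C.continuous_circuit_left θ))
  simp only [dotProduct_expect_mulVec hint, ← norm_sq_eq_opTensor_dotProduct]
  exact integral_complex_ofReal.symm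

theorem integral_norm_expval_sq_le (hq : 2 ≤ q) {M : Fin (q ^ 2) → Matrix (Fin q) (Fin q) ℂ}
    (hM : IsOperatorBasis M) (O : Op n q) (θ : C.Param → ℝ) :
    ∫ V, ‖C.expval O V θ‖ ^ 2 ∂C.gateLaw ≤
      (2 * (q / (q + 1)) : ℝ) ^ n * ∑ x, ‖coeff M O x‖ ^ 2 * (q : ℝ)⁻¹ ^ weight x := by
  have : Nontrivial (Fin q) := Fin.nontrivial_iff_two_le.2 hq
  have hmoment := congrArg Complex.re (C.integral_norm_expval_sq O θ)
  rw [Complex.ofReal_re, expect_lift4_circuit, ← prodTensor_basisState] at hmoment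
  have hstart : symWeight (fun _ : Fin n => basisState (0 : Fin q)) = 2 ^ n := by
    simp [symWeight, purity_basisState, one_add_one_eq_two]
  calc _ ≤ _ := hmoment.trans_le <| re_dotProduct_timeProd_mulVec_le (by positivity)
        (hM.re_opTensor_dotProduct_le O)
        (fun t => (C.isTwoDesign t).isPairTwirl (C.site_ne t) (C.postProd_mem_unitaryGroup θ t)
          (C.preProd_mem_unitaryGroup θ t))
        (fun _ => isState_basisState _) fun k => .inl (C.covered k)
    _ = _ := by rw [hstart, mul_pow]; ring

theorem average_norm_expval_sq_le (hq : 2 ≤ q) {M : Fin (q ^ 2) → Matrix (Fin q) (Fin q) ℂ}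
    (hM : IsOperatorBasis M) (O : Op n q) :
    C.average (fun V θ => ‖C.expval O V θ‖ ^ 2) ≤
      (2 * (q / (q + 1)) : ℝ) ^ n * ∑ x, ‖coeff M O x‖ ^ 2 * (q : ℝ)⁻¹ ^ weight x := by
  have hint := C.integrable_comp_expval (ν := C.gateLaw.prod C.paramLaw) continuous_id
    (φ := fun z => ‖z‖ ^ 2) (by fun_prop) O
  rw [average, integral_integral_swap hint]
  exact (integral_mono hint.integral_prod_right (integrable_const _)
    (C.integral_norm_expval_sq_le hq hM O)).trans_eq (by simp)

end Ansatz

/-! ### Global observables -/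

theorem le_add_one_sq_div_pow_eight {q : ℝ} (hq : 2 ≤ q) : q ≤ ((q + 1) ^ 2 / (4 * q)) ^ 8 := by
  have : 0 < q := by linarith
  have hstep : (q - 1) / 8 ≤ (q - 1) ^ 2 / (4 * q) := by
    rw [div_le_div_iff₀ (by norm_num) (by positivity)]
    nlinarith
  calc q ≤ 1 + (8 : ℕ) * ((q - 1) ^ 2 / (4 * q)) := by push_cast; linarith
    _ ≤ (1 + (q - 1) ^ 2 / (4 * q)) ^ 8 :=
      one_add_mul_le_pow (le_trans (by norm_num) (by positivity : 0 ≤ (q - 1) ^ 2 / (4 * q))) 8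
    _ = ((q + 1) ^ 2 / (4 * q)) ^ 8 := by congr 1; field_simp; ring

theorem two_mul_div_mul_rpow_le {q : ℝ} (hq : 2 ≤ q) :
    2 * (q / (q + 1)) * q ^ (-(1 / 2) : ℝ) ≤ q ^ (-(1 / 16) : ℝ) := by
  have hq0 : 0 < q := by linarith
  refine le_of_pow_le_pow_left₀ (n := 16) (by norm_num) (by positivity) ?_
  calc (2 * (q / (q + 1)) * q ^ (-(1 / 2) : ℝ)) ^ 16
      = (((q + 1) ^ 2 / (4 * q)) ^ 8)⁻¹ := by
        rw [mul_pow, ← Real.rpow_mul_natCast hq0.le]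
        norm_num
        field_simp
        ring
    _ ≤ q⁻¹ := inv_anti₀ hq0 (le_add_one_sq_div_pow_eight hq)
    _ = (q ^ (-(1 / 16) : ℝ)) ^ 16 := by
        rw [← Real.rpow_mul_natCast hq0.le]
        norm_num [Real.rpow_neg_one]

theorem two_mul_div_pow_mul_inv_pow_le {q : ℝ} (hq : 2 ≤ q) {n w : ℕ} (hw : (n : ℝ) / 2 ≤ w) :
    (2 * (q / (q + 1))) ^ n * q⁻¹ ^ w ≤ q ^ (-(1 / 16 * (n : ℝ))) := by
  have hq0 : 0 < q := by linarith
  calc (2 * (q / (q + 1))) ^ n * q⁻¹ ^ w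
      ≤ (2 * (q / (q + 1))) ^ n * (q ^ (-(1 / 2) : ℝ)) ^ n := by
        gcongr
        rw [← Real.rpow_mul_natCast hq0.le, inv_pow, ← Real.rpow_natCast, ← Real.rpow_neg hq0.le]
        exact Real.rpow_le_rpow_of_exponent_le (by linarith) (by linarith)
    _ = (2 * (q / (q + 1)) * q ^ (-(1 / 2) : ℝ)) ^ n := (mul_pow _ _ _).symm
    _ ≤ (q ^ (-(1 / 16) : ℝ)) ^ n := by gcongr; exact two_mul_div_mul_rpow_le hq
    _ = q ^ (-(1 / 16 * (n : ℝ))) := by rw [← Real.rpow_mul_natCast hq0.le, neg_mul]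

namespace Ansatz

variable {n q : ℕ} [NeZero q] (C : Ansatz n q)

theorem average_norm_expval_sq_le_of_weight (hq : 2 ≤ q)
    {M : Fin (q ^ 2) → Matrix (Fin q) (Fin q) ℂ} (hM : IsOperatorBasis M) {O : Op n q}
    (hO : ∀ x, coeff M O x ≠ 0 → (n : ℝ) / 2 ≤ (weight x : ℝ)) :
    C.average (fun V θ => ‖C.expval O V θ‖ ^ 2) ≤
      (q : ℝ) ^ (-(1 / 16 * (n : ℝ))) * ∑ x, ‖coeff M O x‖ ^ 2 := by
  refine (C.average_norm_expval_sq_le hq hM O).trans ?_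
  rw [Finset.mul_sum, Finset.mul_sum]
  refine Finset.sum_le_sum fun x _ => ?_
  rcases eq_or_ne (coeff M O x) 0 with hx | hx
  · simp [hx]
  · rw [mul_left_comm, mul_comm (_ ^ _) (_ ^ 2)]
    gcongr
    exact two_mul_div_pow_mul_inv_pow_le (by exact_mod_cast hq) (hO x hx)

theorem g_le (hq : 2 ≤ q) {M : Fin (q ^ 2) → Matrix (Fin q) (Fin q) ℂ} (hM : IsOperatorBasis M)
    {x : Fin n → Fin (q ^ 2)} (hx : (n : ℝ) / 2 ≤ (weight x : ℝ)) :
    C.g M x ≤ (q : ℝ) ^ (-(1 / 16 * (n : ℝ))) := by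
  have hsupp : ∀ y, coeff M (tensorOp M x) y ≠ 0 → (n : ℝ) / 2 ≤ (weight y : ℝ) := by
    intro y hy
    rw [hM.coeff_tensorOp] at hy
    rwa [of_not_not fun hne => hy (if_neg hne)]
  simpa [hM.coeff_tensorOp, apply_ite, g] using C.average_norm_expval_sq_le_of_weight hq hM hsupp

theorem average_objective_sq_le (hq : 2 ≤ q) {M : Fin (q ^ 2) → Matrix (Fin q) (Fin q) ℂ}
    (hM : IsOperatorBasis M) {H : Op n q}
    (hH : ∀ x, coeff M H x ≠ 0 → (n : ℝ) / 2 ≤ (weight x : ℝ)) :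
    C.average (fun V θ => C.objective H V θ ^ 2) ≤
      (q : ℝ) ^ (-(1 / 16 * (n : ℝ))) * ∑ x, ‖coeff M H x‖ ^ 2 := by
  refine le_trans ?_ (C.average_norm_expval_sq_le_of_weight hq hM hH)
  exact C.average_comp_expval_mono (φ := fun z => z.re ^ 2) (ψ := fun z => ‖z‖ ^ 2) (by fun_prop)
    (by fun_prop) (fun z => sq_le_sq.2 ((Complex.abs_re_le_norm z).trans_eq (abs_norm z).symm)) H

end Ansatz

/-! ### Heisenberg evolution -/

section HeisenbergEvolution

open scoped Matrix.Norms.L2Operator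

theorem norm_onSites_le {n q : ℕ} {i j : Fin n} (hij : i ≠ j)
    (B : Matrix (Fin q × Fin q) (Fin q × Fin q) ℂ) : ‖onSites i j B‖ ≤ ‖B‖ :=
  NonUnitalStarAlgHom.norm_apply_le (onSitesHom hij) B

theorem onSites_exp {n q : ℕ} {i j : Fin n} (hij : i ≠ j)
    (B : Matrix (Fin q × Fin q) (Fin q × Fin q) ℂ) :
    onSites i j (NormedSpace.exp B) = NormedSpace.exp (onSites i j B) := by
  let : NormedAlgebra ℚ (Matrix (Fin q × Fin q) (Fin q × Fin q) ℂ) :=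
    NormedAlgebra.restrictScalars ℚ ℂ _
  let : NormedAlgebra ℚ (Op n q) := NormedAlgebra.restrictScalars ℚ ℂ _
  exact NormedSpace.map_exp (onSitesHom hij) (continuous_onSites i j) B

variable {ι : Type} [Fintype ι] [DecidableEq ι] {A : Matrix ι ι ℂ}

/-- The Heisenberg evolution `e^{iAθ} K e^{-iAθ}` of an observable `K`, for Hermitian `A`. -/
def evolve (A K : Matrix ι ι ℂ) (θ : ℝ) : Matrix ι ι ℂ :=
  (NormedSpace.exp ((-(Complex.I * (θ : ℂ))) • A))ᴴ * K *
    NormedSpace.exp ((-(Complex.I * (θ : ℂ))) • A)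

/-- The derivation `K ↦ i[A, K]` generating the Heisenberg evolution `evolve A`. -/
def generator (A K : Matrix ι ι ℂ) : Matrix ι ι ℂ :=
  Complex.I • (A * K - K * A)

theorem norm_evolve (hA : A.IsHermitian) (K : Matrix ι ι ℂ) (θ : ℝ) : ‖evolve A K θ‖ = ‖K‖ :=
  norm_conjTranspose_mul_mul (exp_mem_unitaryGroup hA θ) K

theorem norm_generator_le (A K : Matrix ι ι ℂ) : ‖generator A K‖ ≤ 2 * ‖A‖ * ‖K‖ :=
  calc ‖generator A K‖ = ‖A * K - K * A‖ := by rw [generator, norm_smul, Complex.norm_I, one_mul]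
    _ ≤ ‖A‖ * ‖K‖ + ‖K‖ * ‖A‖ :=
      (norm_sub_le _ _).trans (add_le_add (norm_mul_le _ _) (norm_mul_le _ _))
    _ = 2 * ‖A‖ * ‖K‖ := by ring

theorem evolve_eq_exp_mul_mul_exp (hA : A.IsHermitian) (K : Matrix ι ι ℂ) (θ : ℝ) :
    evolve A K θ =
      NormedSpace.exp (θ • (Complex.I • A)) * K * NormedSpace.exp (θ • -(Complex.I • A)) := by
  have hexp : (-(Complex.I * (θ : ℂ))) • A = θ • -(Complex.I • A) := by
    rw [smul_neg, neg_smul, mul_comm, mul_smul, Complex.coe_smul]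
  have hskew : (Complex.I • A)ᴴ = -(Complex.I • A) := by
    rw [Matrix.conjTranspose_smul, hA.eq, Complex.star_def, Complex.conj_I, neg_smul]
  rw [evolve, hexp, ← Matrix.exp_conjTranspose, Matrix.conjTranspose_smul,
    Matrix.conjTranspose_neg, hskew, neg_neg, star_trivial]

theorem hasDerivAt_evolve (hA : A.IsHermitian) (K : Matrix ι ι ℂ) (θ : ℝ) :
    HasDerivAt (evolve A K) (evolve A (generator A K) θ) θ := by
  have hleft := hasDerivAt_exp_smul_const (𝕂 := ℝ) (Complex.I • A) θ
  have hright := hasDerivAt_exp_smul_const' (𝕂 := ℝ) (-(Complex.I • A)) θ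
  rw [funext (evolve_eq_exp_mul_mul_exp hA K), evolve_eq_exp_mul_mul_exp hA]
  refine ((hleft.mul_const K).mul hright).congr_deriv ?_
  rw [generator, smul_sub, ← smul_mul_assoc, ← mul_smul_comm]
  noncomm_ring

variable (φ : Matrix ι ι ℂ →L[ℝ] ℝ)

theorem deriv_comp_evolve (hA : A.IsHermitian) (K : Matrix ι ι ℂ) :
    deriv (fun θ => φ (evolve A K θ)) = fun θ => φ (evolve A (generator A K) θ) :=
  funext fun θ => (φ.hasFDerivAt.comp_hasDerivAt θ (hasDerivAt_evolve hA K θ)).deriv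

theorem contDiff_comp_evolve (hA : A.IsHermitian) (K : Matrix ι ι ℂ) (m : ℕ) :
    ContDiff ℝ m fun θ => φ (evolve A K θ) := by
  have hdiff : ∀ K, Differentiable ℝ fun θ => φ (evolve A K θ) := fun K θ =>
    (φ.hasFDerivAt.comp_hasDerivAt θ (hasDerivAt_evolve hA K θ)).differentiableAt
  induction m generalizing K with
  | zero => exact contDiff_zero.2 (hdiff K).continuous
  | succ m ih =>
    rw [Nat.cast_add_one, contDiff_succ_iff_deriv, deriv_comp_evolve φ hA]
    exact ⟨hdiff K, by simp, ih _⟩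

variable {φ}

theorem abs_comp_evolve_le (hA : A.IsHermitian) (hφ : ‖φ‖ ≤ 1) (K : Matrix ι ι ℂ) (θ : ℝ) :
    |φ (evolve A K θ)| ≤ ‖K‖ :=
  calc |φ (evolve A K θ)| ≤ 1 * ‖evolve A K θ‖ := φ.le_of_opNorm_le hφ _
    _ = ‖K‖ := by rw [one_mul, norm_evolve hA]

theorem abs_deriv_comp_evolve_le (hA : A.IsHermitian) (hφ : ‖φ‖ ≤ 1) (K : Matrix ι ι ℂ) (θ : ℝ) :
    |deriv (fun θ => φ (evolve A K θ)) θ| ≤ 2 * ‖A‖ * ‖K‖ := by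
  rw [deriv_comp_evolve φ hA]
  exact (abs_comp_evolve_le hA hφ _ θ).trans (norm_generator_le A K)

theorem abs_deriv_deriv_comp_evolve_le (hA : A.IsHermitian) (hφ : ‖φ‖ ≤ 1) (K : Matrix ι ι ℂ)
    (θ : ℝ) : |deriv (deriv fun θ => φ (evolve A K θ)) θ| ≤ 4 * ‖A‖ ^ 2 * ‖K‖ := by
  rw [deriv_comp_evolve φ hA]
  calc _ ≤ 2 * ‖A‖ * ‖generator A K‖ := abs_deriv_comp_evolve_le hA hφ _ θ
    _ ≤ 2 * ‖A‖ * (2 * ‖A‖ * ‖K‖) := by gcongr; exact norm_generator_le A K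
    _ = 4 * ‖A‖ ^ 2 * ‖K‖ := by ring

end HeisenbergEvolution

/-! ### The landscape along one parameter -/

section Landscape

variable {n q : ℕ}

theorem ParamGate.isUnitaryTranslate_eval (G : ParamGate q) :
    IsUnitaryTranslate G.eval fun s => NormedSpace.exp ((-(Complex.I * (s : ℂ))) • G.A) :=
  ⟨G.Wl.1, G.Wl.2, G.Wr.1, G.Wr.2, fun _ => rfl⟩

namespace Ansatz

variable (C : Ansatz n q)

theorem isUnitaryTranslate_preProd (θ : C.Param → ℝ) (t : Fin C.m) (a : Fin (C.nPre t)) :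
    IsUnitaryTranslate (fun s => C.preProd (Function.update θ ⟨t, Sum.inl a⟩ s) t)
      (C.pre t a).eval := by
  have h := isUnitaryTranslate_timeProd (F := fun a' s => (C.pre t a').eval
    (Function.update θ ⟨t, Sum.inl a⟩ s ⟨t, Sum.inl a'⟩)) a 0
    (fun _ => ParamGate.eval_mem_unitaryGroup _ _) (fun a' ha s => by simp [ha])
  simp only [Function.update_self] at h
  exact h

theorem isUnitaryTranslate_postProd (θ : C.Param → ℝ) (t : Fin C.m) (b : Fin (C.nPost t)) :
    IsUnitaryTranslate (fun s => C.postProd (Function.update θ ⟨t, Sum.inr b⟩ s) t)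
      (C.post t b).eval := by
  have h := isUnitaryTranslate_timeProd (F := fun b' s => (C.post t b').eval
    (Function.update θ ⟨t, Sum.inr b⟩ s ⟨t, Sum.inr b'⟩)) b 0
    (fun _ => ParamGate.eval_mem_unitaryGroup _ _) (fun b' hb s => by simp [hb])
  simp only [Function.update_self] at h
  exact h

theorem isUnitaryTranslate_block (V : C.Realization) (θ : C.Param → ℝ) (l : C.Param) :
    IsUnitaryTranslate (fun s => C.block V (Function.update θ l s) l.1) (C.gate l).eval := by
  obtain ⟨t, a | b⟩ := l
  · have hpost : ∀ s, C.postProd (Function.update θ ⟨t, Sum.inl a⟩ s) t = C.postProd θ t := by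
      simp [postProd]
    simp only [block_eq, hpost]
    exact (isUnitaryTranslate_mul_left (mul_mem (C.postProd_mem_unitaryGroup θ t) (V t).2)).trans
      (C.isUnitaryTranslate_preProd θ t a)
  · have hpre : ∀ s, C.preProd (Function.update θ ⟨t, Sum.inr b⟩ s) t = C.preProd θ t := by
      simp [preProd]
    simp only [block_eq, hpre, mul_assoc]
    exact (isUnitaryTranslate_mul_right (mul_mem (V t).2 (C.preProd_mem_unitaryGroup θ t))).trans
      (C.isUnitaryTranslate_postProd θ t b)

theorem block_update_of_ne (V : C.Realization) (θ : C.Param → ℝ) {l : C.Param} {t : Fin C.m}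
    (ht : t ≠ l.1) (s : ℝ) : C.block V (Function.update θ l s) t = C.block V θ t := by
  have hne : ∀ y, (⟨t, y⟩ : C.Param) ≠ l := fun y h => ht (congrArg Sigma.fst h)
  simp only [block, Function.update_of_ne (hne _)]

theorem isUnitaryTranslate_circuit (V : C.Realization) (θ : C.Param → ℝ) (l : C.Param) :
    IsUnitaryTranslate (fun s => C.circuit V (Function.update θ l s)) fun s =>
      onSites (C.site₁ l.1) (C.site₂ l.1)
        (NormedSpace.exp ((-(Complex.I * (s : ℂ))) • (C.gate l).A)) := by
  have hcircuit := isUnitaryTranslate_timeProd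
    (F := fun t s => onSites (C.site₁ t) (C.site₂ t) (C.block V (Function.update θ l s) t)) l.1 0
    (fun t => onSites_mem_unitaryGroup (C.site_ne t) (C.block_mem_unitaryGroup V _ t))
    (fun t ht s => by simp only [C.block_update_of_ne V θ ht])
  exact hcircuit.trans <| ((C.isUnitaryTranslate_block V θ l).trans
    (C.gate l).isUnitaryTranslate_eval).map (onSitesHom (C.site_ne l.1))

variable [NeZero q] (H : Op n q) (V : C.Realization) (θ : C.Param → ℝ) (l : C.Param)

theorem periodic_objective_update :
    Function.Periodic (fun s => C.objective H V (Function.update θ l s)) (2 * Real.pi) := by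
  obtain ⟨P, -, Q, -, hcircuit⟩ := C.isUnitaryTranslate_circuit V θ l
  intro s
  have hperiodic := (C.gate l).periodic s
  simp only at hcircuit hperiodic
  simp only [objective, expval, hcircuit, hperiodic]

section

open scoped Matrix.Norms.L2Operator

theorem exists_objective_update_eq : ∃ (φ : Op n q →L[ℝ] ℝ) (A K : Op n q), ‖φ‖ ≤ 1 ∧
    A.IsHermitian ∧ ‖A‖ ≤ opNorm (C.gate l).A ∧ ‖K‖ = opNorm H ∧
    (fun s => C.objective H V (Function.update θ l s)) = fun s => φ (evolve A K s) := by
  obtain ⟨P, hP, Q, hQ, hcircuit⟩ := C.isUnitaryTranslate_circuit V θ l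
  let φ : Op n q →ₗ[ℝ] ℝ :=
    Complex.reLm ∘ₗ Matrix.entryLinearMap ℝ ℂ (fun _ => 0) (fun _ => 0) ∘ₗ
      LinearMap.mulRight ℝ Q ∘ₗ LinearMap.mulLeft ℝ Qᴴ
  have hφ : ∀ B, ‖φ B‖ ≤ 1 * ‖B‖ := fun B =>
    calc ‖φ B‖ ≤ ‖(Qᴴ * B * Q) (fun _ => 0) (fun _ => 0)‖ := Complex.abs_re_le_norm _
      _ ≤ ‖Qᴴ * B * Q‖ := norm_entry_le_norm _ _ _
      _ = 1 * ‖B‖ := by rw [norm_conjTranspose_mul_mul hQ, one_mul]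
  refine ⟨φ.mkContinuous 1 hφ, onSites (C.site₁ l.1) (C.site₂ l.1) (C.gate l).A, Pᴴ * H * P,
    φ.mkContinuous_norm_le zero_le_one hφ, ?_, norm_onSites_le (C.site_ne l.1) _,
    norm_conjTranspose_mul_mul hP H, funext fun s => ?_⟩
  · rw [Matrix.IsHermitian, ← onSites_conjTranspose, (C.gate l).isHermitian.eq]
  · simp only at hcircuit
    rw [objective, expval, hcircuit, onSites_exp (C.site_ne l.1), onSites_smul]
    simp [φ, evolve, Matrix.conjTranspose_mul, mul_assoc]

theorem contDiff_objective_update (m : ℕ) :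
    ContDiff ℝ m fun s => C.objective H V (Function.update θ l s) := by
  obtain ⟨φ, A, K, -, hA, -, -, hobjective⟩ := C.exists_objective_update_eq H V θ l
  rw [hobjective]
  exact contDiff_comp_evolve φ hA K m

theorem abs_partialDeriv_le :
    |C.partialDeriv H V θ l| ≤ 2 * opNorm (C.gate l).A * opNorm H := by
  obtain ⟨φ, A, K, hφ, hA, hAle, hK, hobjective⟩ := C.exists_objective_update_eq H V θ l
  rw [partialDeriv, hobjective, ← hK]
  exact (abs_deriv_comp_evolve_le hA hφ K _).trans (by gcongr)

theorem abs_deriv_deriv_objective_update_le (s : ℝ) :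
    |deriv (deriv fun s => C.objective H V (Function.update θ l s)) s| ≤
      4 * opNorm (C.gate l).A ^ 2 * opNorm H := by
  obtain ⟨φ, A, K, hφ, hA, hAle, hK, hobjective⟩ := C.exists_objective_update_eq H V θ l
  rw [hobjective, ← hK]
  exact (abs_deriv_deriv_comp_evolve_le hA hφ K s).trans (by gcongr)

end

end Ansatz

end Landscape

/-! ### A gradient bound for periodic functions -/

section Periodic

theorem periodic_deriv {f : ℝ → ℝ} {T : ℝ} (hf : Function.Periodic f T) :
    Function.Periodic (deriv f) T := fun s => by
  rw [← deriv_comp_add_const, funext hf]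

theorem integral_deriv_sq_le {T B : ℝ} (hT : 0 ≤ T) {f : ℝ → ℝ} (hf : ContDiff ℝ 2 f)
    (hper : Function.Periodic f T) (hB : ∀ s, |deriv (deriv f) s| ≤ B) :
    ∫ s in 0..T, deriv f s ^ 2 ≤ B * ∫ s in 0..T, |f s| := by
  have hf' : ContDiff ℝ 1 (deriv f) := (contDiff_succ_iff_deriv.1 hf).2.2
  have hf'' : Continuous (deriv (deriv f)) := hf'.continuous_deriv le_rfl
  have hparts : ∫ s in 0..T, deriv f s ^ 2 = ∫ s in 0..T, -(deriv (deriv f) s * f s) := by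
    simp only [sq]
    rw [intervalIntegral.integral_mul_deriv_eq_deriv_mul
      (fun s _ => (hf'.differentiable one_ne_zero s).hasDerivAt)
      (fun s _ => (hf.differentiable two_ne_zero s).hasDerivAt)
      (hf''.intervalIntegrable _ _) (hf'.continuous.intervalIntegrable _ _),
      hper.eq, (periodic_deriv hper).eq, sub_self, zero_sub, intervalIntegral.integral_neg]
  rw [hparts, ← intervalIntegral.integral_const_mul]
  refine intervalIntegral.integral_mono_on hT
    ((hf''.mul hf.continuous).neg.intervalIntegrable _ _)
    ((continuous_const.mul hf.continuous.abs).intervalIntegrable _ _) fun s _ => ?_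
  calc -(deriv (deriv f) s * f s) ≤ |deriv (deriv f) s| * |f s| :=
        (neg_le_abs _).trans_eq (abs_mul _ _)
    _ ≤ B * |f s| := mul_le_mul_of_nonneg_right (hB s) (abs_nonneg _)

theorem integral_cond_Icc {T : ℝ} (hT : 0 ≤ T) (f : ℝ → ℝ) :
    ∫ s, f s ∂(ProbabilityTheory.cond volume (Set.Icc 0 T)) = T⁻¹ * ∫ s in 0..T, f s := by
  rw [ProbabilityTheory.cond, integral_smul_measure, intervalIntegral.integral_of_le hT,
    integral_Icc_eq_integral_Ioc]
  simp [Real.volume_Icc, hT]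

end Periodic

section Resampling

variable {ι α : Type*} [Fintype ι] [DecidableEq ι] [MeasurableSpace α]
  (μ : ι → Measure α) [∀ i, IsProbabilityMeasure (μ i)] (l : ι)

theorem measurePreserving_update :
    MeasurePreserving (fun p : (ι → α) × α => Function.update p.1 l p.2)
      ((Measure.pi μ).prod (μ l)) (Measure.pi μ) := by
  have hmeas : Measurable fun p : (ι → α) × α => Function.update p.1 l p.2 := measurable_update'
  refine ⟨hmeas, (Measure.pi_eq fun s hs => ?_).symm⟩
  have hpreimage : (fun p : (ι → α) × α => Function.update p.1 l p.2) ⁻¹' Set.univ.pi s =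
      Set.univ.pi (Function.update s l Set.univ) ×ˢ s l := by
    ext p
    simp only [Set.mem_preimage, Set.mem_univ_pi, Set.mem_prod]
    rw [Function.forall_update_iff p.1 fun i y => y ∈ s i,
      Function.forall_update_iff s fun i y => p.1 i ∈ y]
    simp [and_comm]
  rw [Measure.map_apply hmeas (MeasurableSet.univ_pi hs), hpreimage, Measure.prod_prod,
    Measure.pi_pi, ← Finset.mul_prod_erase _ _ (Finset.mem_univ l),
    ← Finset.mul_prod_erase Finset.univ (fun i => μ i (s i)) (Finset.mem_univ l),
    Function.update_self, measure_univ, one_mul, mul_comm]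
  congr 1
  exact Finset.prod_congr rfl fun i hi => by
    rw [Function.update_of_ne (Finset.ne_of_mem_erase hi)]

variable {μ} {f : (ι → α) → ℝ}

theorem integral_pi_le_of_integral_update_le {g : (ι → α) → ℝ} (hf : Integrable f (Measure.pi μ))
    (hg : Integrable g (Measure.pi μ))
    (h : ∀ θ, ∫ s, f (Function.update θ l s) ∂μ l ≤ ∫ s, g (Function.update θ l s) ∂μ l) :
    ∫ θ, f θ ∂Measure.pi μ ≤ ∫ θ, g θ ∂Measure.pi μ := by
  have hmp := measurePreserving_update μ l
  have resample : ∀ {k : (ι → α) → ℝ}, Integrable k (Measure.pi μ) →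
      ∫ θ, k θ ∂Measure.pi μ =
        ∫ θ, ∫ s, k (Function.update θ l s) ∂μ l ∂Measure.pi μ := fun {k} hk => by
    conv_lhs => rw [← hmp.map_eq]
    rw [integral_map hmp.aemeasurable (by rw [hmp.map_eq]; exact hk.1)]
    exact integral_prod _ (hmp.integrable_comp_of_integrable hk)
  rw [resample hf, resample hg]
  exact integral_mono (hmp.integrable_comp_of_integrable hf).integral_prod_left
    (hmp.integrable_comp_of_integrable hg).integral_prod_left h

end Resampling

/-! ### The gradient -/

namespace Ansatz

variable {n q : ℕ} [NeZero q] (C : Ansatz n q) (H : Op n q) (V : C.Realization)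

theorem partialDeriv_update (θ : C.Param → ℝ) (l : C.Param) (s : ℝ) :
    C.partialDeriv H V (Function.update θ l s) l =
      deriv (fun u => C.objective H V (Function.update θ l u)) s := by
  simp [partialDeriv]

theorem measurable_partialDeriv (l : C.Param) :
    Measurable fun θ => C.partialDeriv H V θ l := by
  have hupdate : Continuous fun p : (C.Param → ℝ) × ℝ => (V, Function.update p.1 l p.2) :=
    continuous_const.prodMk (continuous_fst.update l continuous_snd)
  have hexpval := (C.continuous_expval H).comp' hupdate
  have hobjective : Continuous (Function.uncurry fun θ s =>
      C.objective H V (Function.update θ l s)) := Complex.continuous_re.comp' hexpval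
  have hdiag : Measurable fun θ : C.Param → ℝ => (θ, θ l) :=
    measurable_id.prodMk (measurable_pi_apply l)
  have hpartial := (measurable_deriv_with_param hobjective).fun_comp hdiag
  simpa only [partialDeriv] using hpartial

theorem integrable_partialDeriv_sq (l : C.Param) :
    Integrable (fun θ => C.partialDeriv H V θ l ^ 2) C.paramLaw :=
  .of_bound ((C.measurable_partialDeriv H V l).pow_const 2).aestronglyMeasurable
    ((2 * opNorm (C.gate l).A * opNorm H) ^ 2) <| .of_forall fun θ => by
      rw [norm_pow, Real.norm_eq_abs]
      gcongr
      exact C.abs_partialDeriv_le H V θ l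

theorem integral_partialDeriv_sq_le (l : C.Param) :
    ∫ θ, C.partialDeriv H V θ l ^ 2 ∂C.paramLaw ≤
      4 * opNorm (C.gate l).A ^ 2 * opNorm H * ∫ θ, |C.objective H V θ| ∂C.paramLaw := by
  have hobjective : Integrable (fun θ => |C.objective H V θ|) C.paramLaw :=
    C.integrable_comp_expval (p := fun θ => (V, θ)) (φ := fun z => |z.re|)
      (by fun_prop) (by fun_prop) H
  rw [← integral_const_mul]
  refine integral_pi_le_of_integral_update_le l (C.integrable_partialDeriv_sq H V l)
    (hobjective.const_mul _) fun θ => ?_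
  have hpi : 0 ≤ 2 * Real.pi := by positivity
  simp only [partialDeriv_update]
  rw [integral_const_mul, integral_cond_Icc hpi, integral_cond_Icc hpi, mul_left_comm]
  exact mul_le_mul_of_nonneg_left
    (integral_deriv_sq_le hpi (C.contDiff_objective_update H V θ l 2)
      (C.periodic_objective_update H V θ l) (C.abs_deriv_deriv_objective_update_le H V θ l))
    (inv_nonneg.2 hpi)

theorem average_gradNormSq_le :
    C.average (C.gradNormSq H) ≤ 4 * (∑ l, opNorm (C.gate l).A ^ 2) * opNorm H *
      C.average fun V θ => |C.objective H V θ| := by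
  have hobjective : Integrable (fun p : C.Realization × (C.Param → ℝ) => |C.objective H p.1 p.2|)
      (C.gateLaw.prod C.paramLaw) :=
    C.integrable_comp_expval continuous_id (φ := fun z => |z.re|) (by fun_prop) H
  rw [average, average, ← integral_const_mul]
  refine integral_mono_of_nonneg
    (.of_forall fun V => integral_nonneg fun θ => Finset.sum_nonneg fun l _ => sq_nonneg _)
    (hobjective.integral_prod_left.const_mul _) (.of_forall fun V => ?_)
  simp only [gradNormSq]
  rw [integral_finsetSum _ fun l _ => C.integrable_partialDeriv_sq H V l, Finset.mul_sum,
    Finset.sum_mul, Finset.sum_mul]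
  exact Finset.sum_le_sum fun l _ => C.integral_partialDeriv_sq_le H V l

variable {C H}

theorem average_gradNormSq_le_of_weight (hq : 2 ≤ q)
    {M : Fin (q ^ 2) → Matrix (Fin q) (Fin q) ℂ} (hM : IsOperatorBasis M)
    (hH : ∀ x, coeff M H x ≠ 0 → (n : ℝ) / 2 ≤ (weight x : ℝ)) :
    C.average (C.gradNormSq H) ≤ 4 * (∑ l, opNorm (C.gate l).A ^ 2) * opNorm H *
      ((q : ℝ) ^ (-(1 / 16 * (n : ℝ) / 2)) * √(∑ x, ‖coeff M H x‖ ^ 2)) := by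
  have habs : C.average (fun V θ => |C.objective H V θ|) ≤
      (q : ℝ) ^ (-(1 / 16 * (n : ℝ) / 2)) * √(∑ x, ‖coeff M H x‖ ^ 2) :=
    calc C.average (fun V θ => |C.objective H V θ|)
        ≤ √(C.average fun V θ => C.objective H V θ ^ 2) := C.average_abs_objective_le H
      _ ≤ √((q : ℝ) ^ (-(1 / 16 * (n : ℝ))) * ∑ x, ‖coeff M H x‖ ^ 2) :=
        Real.sqrt_le_sqrt (C.average_objective_sq_le hq hM hH)
      _ = (q : ℝ) ^ (-(1 / 16 * (n : ℝ) / 2)) * √(∑ x, ‖coeff M H x‖ ^ 2) := by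
        rw [Real.sqrt_mul (by positivity), Real.sqrt_eq_rpow, ← Real.rpow_mul q.cast_nonneg,
          neg_mul, mul_one_div]
  exact (C.average_gradNormSq_le H).trans <|
    mul_le_mul_of_nonneg_left habs (mul_nonneg (by positivity) (norm_nonneg _))

end Ansatz

end BarrenPlateau

end

theorem corollary2_general {n q : ℕ} [NeZero q] (hq : 2 ≤ q) (C : BarrenPlateau.Ansatz n q)
    {M : Fin (q ^ 2) → Matrix (Fin q) (Fin q) ℂ} (hM : BarrenPlateau.IsOperatorBasis M) :
    (∀ x : Fin n → Fin (q ^ 2), (n : ℝ) / 2 ≤ (BarrenPlateau.weight x : ℝ) →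
      C.g M x ≤ (q : ℝ) ^ (-(1 / 16 * (n : ℝ)))) ∧
    ∀ H : BarrenPlateau.Op n q,
      (∀ x : Fin n → Fin (q ^ 2), BarrenPlateau.coeff M H x ≠ 0 →
        (n : ℝ) / 2 ≤ (BarrenPlateau.weight x : ℝ)) →
      C.average (fun V θ => C.objective H V θ ^ 2) ≤
          (q : ℝ) ^ (-(1 / 16 * (n : ℝ))) * ∑ x, ‖BarrenPlateau.coeff M H x‖ ^ 2 ∧
      C.average (C.gradNormSq H) ≤
          4 * (∑ l, BarrenPlateau.opNorm (C.gate l).A ^ 2) * BarrenPlateau.opNorm H *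
            ((q : ℝ) ^ (-(1 / 16 * (n : ℝ) / 2)) *
              Real.sqrt (∑ x, ‖BarrenPlateau.coeff M H x‖ ^ 2)) :=
  ⟨fun _ hx => C.g_le hq hM hx, fun _ hH =>
    ⟨C.average_objective_sq_le hq hM hH, C.average_gradNormSq_le_of_weight hq hM hH⟩⟩

theorem corollary2 :
    ∃ c : ℝ, 0 < c ∧
      ∀ (q n : ℕ) [NeZero q], 2 ≤ q →
      ∀ (C : BarrenPlateau.Ansatz n q) (M : Fin (q ^ 2) → Matrix (Fin q) (Fin q) ℂ),
        BarrenPlateau.IsOperatorBasis M →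
        (∀ x : Fin n → Fin (q ^ 2), (n : ℝ) / 2 ≤ (BarrenPlateau.weight x : ℝ) →
          C.g M x ≤ (q : ℝ) ^ (-(c * (n : ℝ)))) ∧
        (∀ H : BarrenPlateau.Op n q, H.IsHermitian →
          (∀ x : Fin n → Fin (q ^ 2), BarrenPlateau.coeff M H x ≠ 0 →
            (n : ℝ) / 2 ≤ (BarrenPlateau.weight x : ℝ)) →
          C.average (fun V θ => C.objective H V θ ^ 2) ≤
              (q : ℝ) ^ (-(c * (n : ℝ))) * ∑ x, ‖BarrenPlateau.coeff M H x‖ ^ 2 ∧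
          C.average (C.gradNormSq H) ≤
              4 * (∑ l, BarrenPlateau.opNorm (C.gate l).A ^ 2) * BarrenPlateau.opNorm H *
                ((q : ℝ) ^ (-(c * (n : ℝ) / 2)) *
                  Real.sqrt (∑ x, ‖BarrenPlateau.coeff M H x‖ ^ 2))) :=
  ⟨1 / 16, by norm_num, fun _ _ _ hq C _ hM => ⟨(corollary2_general hq C hM).1,
    fun H _ => (corollary2_general hq C hM).2 H⟩⟩
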